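/- **Setting.** Fix $G,\gamma,\ell_o>0$ and put $k=8\pi G$. Connections live on the trivial bundle over $\mathbb R^3$, with components taken in the basis $\tau_i=-\frac i2\sigma_i$. Let $\mathring A^i_a\neq 0$ be a smooth $\mathrm{SU}(2)$ connection invariant under the Euclidean group (acting by $y\mapsto ry+x$ together with the constant gauge rotation $r$). Let $\mathring e^a_i$ be the triad with $\mathring e^a_i\mathring A^j_a=\ell_o^{-1}\delta^j_i$, let $\mathring q$ be its metric, and put $\tilde E(p)=p\,\ell_o^{-2}\sqrt{\mathring q}\,\mathring e$. The symmetric phase space points are $(c\mathring A,\tilde E(p))$ with $c,p\in\mathbb R$. Write $r(c)=c\mathring A$. *Loop quantum gravity.* $\overline{\mathcal A}$ (resp. $\overline{\mathcal A}^{\mathbb C}$) is the space of generalized $\mathrm{SU}(2)$ (resp. $\mathrm{SL}(2,\mathbb C)$) connections, i.e. maps $A$ from piecewise analytic curves to the group with $A(e_2\circ e_1)=A(e_2)A(e_1)$ and $A(e^{-1})=A(e)^{-1}$; a smooth connection is identified with its holonomies. Let $\mu^o$ be the Ashtekar–Lewandowski measure and $\mathcal H=L^2(\overline{\mathcal A},\mu^o)$.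 $\underline{\mathrm{Cyl}}$ is the space of functions $f(A(e_1),\dots,A(e_n))$ with $e_1,\dots,e_n$ straight edges and $f:\mathrm{SU}(2)^n\to\mathbb C$ real analytic. A holomorphic cylindrical function is a function $\tilde F(\mathfrak Z(e_1),\dots,\mathfrak Z(e_n))$ on $\overline{\mathcal A}^{\mathbb C}$ with $e_i$ straight and $\tilde F:\mathrm{SL}(2,\mathbb C)^n\to\mathbb C$ holomorphic. *Loop quantum cosmology.* $\mathrm{Cyl}_S=r^*[\underline{\mathrm{Cyl}}]$, a space of almost periodic functions of $c\in\mathbb R$, inside $\mathcal H_S=L^2(\overline{\mathbb R}_{Bohr})$ with orthonormal basis $e^{i\mu c/2}$, $\mu\in\mathbb R$; and $\hat p=-i\frac{k\gamma}{3}\frac{d}{dc}$. *Complexifiers.* Let $C=C(\tilde E)\ge 0$ and $C_S=C_S(p)\ge 0$ be pure momentum complexifiers, $C_S$ differentiable, such that $\frac{\delta C}{\delta\tilde E}$ exists as a smooth one-form at every $\tilde E(p)$, and such that $\frac{\delta C}{\delta\tilde E}(\tilde E(p))$ and $C_S'(p)$ each vanish if and only if $p=0$. Let $\hat C$ be a non-negative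 self-adjoint operator on $\mathcal H$ and $\hat C_S=C_S(\hat p)$. Put $z=c-i\frac{k\gamma}{3}C_S'(p)$ and $\mathfrak Z=c\mathring A-ik\gamma\frac{\delta C}{\delta\tilde E}(\tilde E(p))$. Assume that $s$ is a holomorphic map from $\mathbb C$ to smooth $\mathrm{SL}(2,\mathbb C)$ connections (holomorphic componentwise at each point of space) with $s(z[\xi])=\mathfrak Z[\xi]$ at every symmetric phase space point $\xi$. *Operators, each on its natural domain.* - $U\Phi$, for $\Phi\in\underline{\mathrm{Cyl}}$, is the holomorphic cylindrical function that extends $e^{-\hat C}\Phi$. - $U_S\phi$, for $\phi\in\mathrm{Cyl}_S$, is the entire function that extends $e^{-\hat C_S}\phi\in\mathrm{Cyl}_S$. - $F(\hat{\mathfrak Z})$ is defined by $U(F(\hat{\mathfrak Z})\Phi)=F\cdot U\Phi$, and $F(s(\hat z))$ by $U_S(F(s(\hat z))\phi)=(F\circ s)\cdot U_S\phi$. - $\pi=U_S^{-1}\circ s^*\circ U:\underline{\mathrm{Cyl}}\to\mathrm{Cyl}_S$. - The $b$-embedding is $\iota_b[\psi](\Phi)=\psi(\pi\Phi)$. - The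 dual action of an operator $T$ is $(T^*\Lambda)(\Phi)=\Lambda(T\Phi)$, defined where $T\Phi$ exists and lies in the domain of $\Lambda$. The dual action of $F(s(\hat z))$ is written $F(s(\hat z))^\dagger$. **Proposition.** Let $F$ be a holomorphic cylindrical function (of finitely many holonomies along straight edges). 1. $F\circ s$ is a holomorphic function of finitely many of the $e^{i\mu z/2}$, $\mu\in\mathbb R$; and $\pi$, $F(\hat{\mathfrak Z})$, $F(s(\hat z))$ are well-defined (single-valued, linear, partially defined) operators. 2. The $b$-embedding intertwines the dual actions: $$F(\hat{\mathfrak Z})^*\circ\iota_b=\iota_b\circ F(s(\hat z))^\dagger .$$ That is, for every $\psi$ in the algebraic dual $\mathrm{Cyl}_S^*$ and every $\Phi\in\underline{\mathrm{Cyl}}$ in the domains of $\pi$ and $F(\hat{\mathfrak Z})$, one side is defined at $\Phi$ if and only if the other is, and then $$\big(F(\hat{\mathfrak Z})^*\iota_b[\psi]\big)(\Phi)=\iota_b\big[F(s(\hat z))^\dagger\psi\big](\Phi).$$ 3. If $U\Phi$ exists and is a polynomial in matrix entries of holonomies along straight edges, then $\Phi$ is in the domain of $\pi$, so that $\iota_b[\psi](\Phi)$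 is defined for every $\psi\in\mathrm{Cyl}_S^*$. If $F$ is also such a polynomial, then $\iota_b[F(s(\hat z))^\dagger\psi](\Phi)$ is defined as well. -/

import Mathlib

open scoped ContDiff

namespace LoopQG

noncomputable section

attribute [local instance] Matrix.normedAddCommGroup Matrix.normedSpace

/-- Space, the manifold carrying the (spatially flat) fields. -/
abbrev Space : Type := EuclideanSpace ℝ (Fin 3)

/-- Complex `2 × 2` matrices. -/
abbrev Mat : Type := Matrix (Fin 2) (Fin 2) ℂ

/-- The group `SU(2)` as a set of matrices. -/
def SU2 : Set Mat := (Matrix.specialUnitaryGroup (Fin 2) ℂ : Set Mat)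

/-- The group `SL(2,ℂ)` as a set of matrices. -/
def SL2 : Set Mat := {g | g.det = 1}

/-! ### Curves and straight edges -/

/-- A function restricts to a piecewise analytic curve on `[0,1]`: on each closed interval of a
partition it is real analytic up to the end points, with nowhere vanishing velocity. -/
def IsPiecewiseAnalytic (γ : ℝ → Space) : Prop :=
  ∃ (n : ℕ) (t : Fin (n + 1) → ℝ), StrictMono t ∧ t 0 = 0 ∧ t (Fin.last n) = 1 ∧
    ∀ i : Fin n, AnalyticOn ℝ γ (Set.Icc (t i.castSucc) (t i.succ)) ∧
      ∀ x ∈ Set.Icc (t i.castSucc) (t i.succ),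
        derivWithin γ (Set.Icc (t i.castSucc) (t i.succ)) x ≠ 0

/-- A parametrized piecewise analytic curve; only its values on `[0,1]` matter. -/
structure Curve where
  toFun : ℝ → Space
  piecewiseAnalytic : IsPiecewiseAnalytic toFun

/-- An oriented straight edge, given by its two (distinct) end points. -/
structure StraightEdge where
  src : Space
  tgt : Space
  ne : src ≠ tgt

/-- The straight edge as a curve `t ↦ src + t (tgt - src)`. -/
def StraightEdge.toCurve (e : StraightEdge) : Curve where
  toFun t := e.src + t • (e.tgt - e.src)
  piecewiseAnalytic := by
    refine ⟨1, ![0, 1], ?_, rfl, rfl, ?_⟩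
    · intro i j hij
      fin_cases i <;> fin_cases j <;> simp_all
    · intro i
      have hi : i = 0 := Subsingleton.elim _ _
      subst hi
      refine ⟨?_, ?_⟩
      · exact analyticOn_const.add (analyticOn_id.smul analyticOn_const)
      · intro x hx
        have hd : HasDerivAt (fun t : ℝ => e.src + t • (e.tgt - e.src)) (e.tgt - e.src) x := by
          simpa using ((hasDerivAt_id x).smul_const (e.tgt - e.src)).const_add e.src
        have hu : UniqueDiffWithinAt ℝ (Set.Icc (0 : ℝ) 1) x :=
          uniqueDiffOn_Icc zero_lt_one x hx
        have h := hd.hasDerivWithinAt.derivWithin hu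
        intro h0
        exact e.ne (sub_eq_zero.mp (h.symm.trans h0)).symm

/-! ### Generalized connections -/

/-- A generalized connection with structure group `S`: a map from piecewise analytic curves to `S`,
with no continuity requirement, that depends on the curve up to reparametrization only and
satisfies `A(e₂ ∘ e₁) = A(e₂) A(e₁)` and `A(e⁻¹) = A(e)⁻¹`. -/
@[ext]
structure GenConn (S : Set Mat) where
  toFun : Curve → Mat
  mem : ∀ γ, toFun γ ∈ S
  reparam : ∀ (γ γ' : Curve) (τ : ℝ → ℝ), ContinuousOn τ (Set.Icc 0 1) →
    StrictMonoOn τ (Set.Icc 0 1) → τ 0 = 0 → τ 1 = 1 →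
    (∃ P : Set ℝ, P.Finite ∧ ∀ t ∈ Set.Ioo (0 : ℝ) 1 \ P, DifferentiableAt ℝ τ t) →
    (∀ t ∈ Set.Icc (0 : ℝ) 1, γ'.toFun t = γ.toFun (τ t)) → toFun γ' = toFun γ
  comp : ∀ γ₁ γ₂ γ : Curve,
    (∀ t ∈ Set.Icc (0 : ℝ) (1 / 2), γ.toFun t = γ₁.toFun (2 * t)) →
    (∀ t ∈ Set.Icc (1 / 2 : ℝ) 1, γ.toFun t = γ₂.toFun (2 * t - 1)) →
    toFun γ = toFun γ₂ * toFun γ₁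
  inv : ∀ γ γ' : Curve, (∀ t ∈ Set.Icc (0 : ℝ) 1, γ'.toFun t = γ.toFun (1 - t)) →
    toFun γ' * toFun γ = 1

/-- Topology of pointwise convergence on the set of curves. -/
instance (S : Set Mat) : TopologicalSpace (GenConn S) :=
  TopologicalSpace.induced GenConn.toFun inferInstance

instance (S : Set Mat) : MeasurableSpace (GenConn S) := borel _

instance (S : Set Mat) : BorelSpace (GenConn S) := ⟨rfl⟩

/-- The trivial generalized connection. -/
def GenConn.trivial {S : Set Mat} (h : (1 : Mat) ∈ S) : GenConn S where
  toFun _ := 1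
  mem _ := h
  reparam := by intros; rfl
  comp := by intros; simp
  inv := by intros; simp

lemma one_mem_SU2 : (1 : Mat) ∈ SU2 := one_mem (Matrix.specialUnitaryGroup (Fin 2) ℂ)

lemma one_mem_SL2 : (1 : Mat) ∈ SL2 := by simp [SL2]

lemma SU2_subset_SL2 : SU2 ⊆ SL2 := fun _ hg => hg.2

/-- The inclusion of generalized `SU(2)` connections into generalized `SL(2,ℂ)` connections. -/
def GenConn.complexify (A : GenConn SU2) : GenConn SL2 where
  toFun := A.toFun
  mem γ := SU2_subset_SL2 (A.mem γ)
  reparam := A.reparam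
  comp := A.comp
  inv := A.inv

/-! ### Smooth connections and their holonomies -/

/-- The basis `τ_i = -(i/2) σ_i` of `su(2)`. -/
def tau : Fin 3 → Mat :=
  ![!![0, -Complex.I / 2; -Complex.I / 2, 0],
    !![0, -1 / 2; 1 / 2, 0],
    !![-Complex.I / 2, 0; 0, Complex.I / 2]]

/-- Real `su(2)`-valued one-forms `A^i_a(x)`, in components with respect to `τ_i`. -/
abbrev RealForm : Type := Space → Space →L[ℝ] Space

/-- `sl(2,ℂ)`-valued one-forms, in components with respect to `τ_i`. -/
abbrev ComplexForm : Type := Space → Space →L[ℝ] (Fin 3 → ℂ)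

/-- Smooth `SU(2)` connections on the trivial bundle over space. -/
def SmoothConn : Type := {A : RealForm // ContDiff ℝ ∞ A}

/-- Smooth `SL(2,ℂ)` connections on the trivial bundle over space. -/
def SmoothConnC : Type := {Z : ComplexForm // ContDiff ℝ ∞ Z}

/-- A real one-form regarded as a complex one. -/
def toComplexForm (A : RealForm) : ComplexForm := fun x =>
  (ContinuousLinearMap.pi fun i : Fin 3 =>
    Complex.ofRealCLM.comp (EuclideanSpace.proj i : Space →L[ℝ] ℝ)).comp (A x)

/-- `g` is the holonomy of `Z` along `γ`: the value at time `1` of the solution of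
`u' = Z(γ') u`, `u(0) = 1`. -/
def IsHolonomy (Z : ComplexForm) (γ : Curve) (g : Mat) : Prop :=
  ∃ u : ℝ → Mat, ContinuousOn u (Set.Icc 0 1) ∧ u 0 = 1 ∧ u 1 = g ∧
    ∃ P : Set ℝ, P.Finite ∧ ∀ t ∈ Set.Ioo (0 : ℝ) 1 \ P,
      HasDerivAt u ((∑ i, Z (γ.toFun t) (deriv γ.toFun t) i • tau i) * u t) t

open Classical in
/-- The generalized connection given by the holonomies of a one-form (for a smooth connection it
exists and is unique). -/
def holonomies {S : Set Mat} (h1 : (1 : Mat) ∈ S) (Z : ComplexForm) : GenConn S :=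
  if h : ∃ A : GenConn S, ∀ γ, IsHolonomy Z γ (A.toFun γ) then h.choose else GenConn.trivial h1

/-! ### Cylindrical functions -/

/-- Functions of finitely many holonomies along straight edges, analytic over `𝕜` in the
holonomies. A function on the submanifold `Sⁿ` of the space of `n`-tuples of matrices is analytic
when near each point of `Sⁿ` it is the restriction of a convergent power series in the matrix
entries. -/
def cyl (𝕜 : Type) [NontriviallyNormedField 𝕜] [NormedAlgebra 𝕜 ℂ] (S : Set Mat) :
    Submodule ℂ (GenConn S → ℂ) where
  carrier := {Φ | ∃ (n : ℕ) (e : Fin n → StraightEdge) (f : (Fin n → Mat) → ℂ),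
    AnalyticOn 𝕜 f {g | ∀ i, g i ∈ S} ∧ ∀ A, Φ A = f fun i => A.toFun (e i).toCurve}
  zero_mem' := ⟨0, Fin.elim0, 0, analyticOn_const, fun _ => rfl⟩
  add_mem' := by
    rintro Φ Ψ ⟨n, e, f, hf, hΦ⟩ ⟨m, e', f', hf', hΨ⟩
    refine ⟨n + m, Fin.append e e',
      fun g => f (fun i => g (Fin.castAdd m i)) + f' (fun i => g (Fin.natAdd n i)), ?_, ?_⟩
    · refine AnalyticOn.add ?_ ?_
      · let L : (Fin (n + m) → Mat) →L[𝕜] (Fin n → Mat) :=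
          ContinuousLinearMap.pi fun i => ContinuousLinearMap.proj (Fin.castAdd m i)
        exact hf.comp (L.analyticOn _) (fun g hg i => hg _)
      · let L : (Fin (n + m) → Mat) →L[𝕜] (Fin m → Mat) :=
          ContinuousLinearMap.pi fun i => ContinuousLinearMap.proj (Fin.natAdd n i)
        exact hf'.comp (L.analyticOn _) (fun g hg i => hg _)
    · intro A
      simp [hΦ, hΨ]
  smul_mem' := by
    rintro c Φ ⟨n, e, f, hf, hΦ⟩
    exact ⟨n, e, fun g => c * f g, analyticOn_const.mul hf, fun A => by simp [hΦ]⟩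

/-- Cylindrical functions of full loop quantum gravity based on straight edges: real analytic
functions on `SU(2)ⁿ` of finitely many holonomies. -/
abbrev Cyl : Submodule ℂ (GenConn SU2 → ℂ) := cyl ℝ SU2

/-- Holomorphic cylindrical functions based on straight edges: holomorphic functions on
`SL(2,ℂ)ⁿ` of finitely many holonomies. -/
abbrev HolCyl : Submodule ℂ (GenConn SL2 → ℂ) := cyl ℂ SL2

/-! ### The Ashtekar–Lewandowski measure and the kinematical Hilbert space -/

/-- The curves are the edges of a graph: analytic, embedded, and meeting only at end points. -/
def IsGraph {n : ℕ} (γ : Fin n → Curve) : Prop :=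
  (∀ i, AnalyticOn ℝ (γ i).toFun (Set.Icc 0 1) ∧ Set.InjOn (γ i).toFun (Set.Icc 0 1) ∧
    ∀ x ∈ Set.Icc (0 : ℝ) 1, derivWithin (γ i).toFun (Set.Icc 0 1) x ≠ 0) ∧
  ∀ i j, i ≠ j → ∀ s ∈ Set.Icc (0 : ℝ) 1, ∀ t ∈ Set.Icc (0 : ℝ) 1,
    (γ i).toFun s = (γ j).toFun t → (s = 0 ∨ s = 1) ∧ (t = 0 ∨ t = 1)

/-- The Ashtekar–Lewandowski measure: the regular faithful Borel probability measure for which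
the holonomies along the edges of any graph are distributed according to the normalized Haar
measure of `SU(2)ⁿ`, that is, have a left translation invariant law. -/
structure IsAshtekarLewandowski (μ : MeasureTheory.Measure (GenConn SU2)) : Prop where
  prob : MeasureTheory.IsProbabilityMeasure μ
  regular : μ.Regular
  faithful : μ.IsOpenPosMeasure
  haar : ∀ (n : ℕ) (γ : Fin n → Curve), IsGraph γ → ∀ g : Fin n → Mat, (∀ i, g i ∈ SU2) →
    ∀ f : (Fin n → Mat) → ℂ, Continuous f →
      ∫ A, f (fun i => g i * A.toFun (γ i)) ∂μ = ∫ A, f (fun i => A.toFun (γ i)) ∂μ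

/-- The kinematical Hilbert space `L²` over generalized `SU(2)` connections. -/
abbrev Hilb (μ : MeasureTheory.Measure (GenConn SU2)) : Type := MeasureTheory.Lp ℂ 2 μ

/-- `y = e^{-T} x` for a non-negative self-adjoint operator `T`, by the heat flow `u' = -T u`. -/
def IsExpNeg {H : Type*} [NormedAddCommGroup H] [InnerProductSpace ℂ H]
    (T : H →ₗ.[ℂ] H) (x y : H) : Prop :=
  ∃ u : ℝ → H, ContinuousOn u (Set.Ici 0) ∧ u 0 = x ∧ u 1 = y ∧
    ∀ t : ℝ, 0 < t → ∃ ht : u t ∈ T.domain, HasDerivAt u (-(T ⟨u t, ht⟩)) t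

/-- The graph of the transform `U` to the holomorphic representation: `(Φ, W)` belongs to it when
`W` is a holomorphic cylindrical function that extends `e^{-Ĉ} Φ` analytically from `SU(2)` to
`SL(2,ℂ)` connections. -/
def holTransform (μ : MeasureTheory.Measure (GenConn SU2)) (Chat : Hilb μ →ₗ.[ℂ] Hilb μ) :
    Submodule ℂ (Cyl × (GenConn SL2 → ℂ)) where
  carrier := {q | q.2 ∈ HolCyl ∧ ∃ h h' : Hilb μ, h =ᵐ[μ] (q.1 : GenConn SU2 → ℂ) ∧
    IsExpNeg Chat h h' ∧ h' =ᵐ[μ] fun A => q.2 A.complexify}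
  zero_mem' := by
    refine ⟨HolCyl.zero_mem, 0, 0, MeasureTheory.Lp.coeFn_zero _ _ _, ?_,
      MeasureTheory.Lp.coeFn_zero _ _ _⟩
    refine ⟨fun _ => 0, continuousOn_const, rfl, rfl, fun t _ => ⟨Chat.domain.zero_mem, ?_⟩⟩
    have h0 : Chat ⟨0, Chat.domain.zero_mem⟩ = 0 := Chat.map_zero
    rw [h0, neg_zero]
    exact hasDerivAt_const t 0
  add_mem' := by
    rintro ⟨Φ, W⟩ ⟨Φ₂, W₂⟩ ⟨hW, h, h', hh, ⟨u, hu, hu0, hu1, hud⟩, hh'⟩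
      ⟨hW₂, k, k', hk, ⟨v, hv, hv0, hv1, hvd⟩, hk'⟩
    refine ⟨HolCyl.add_mem hW hW₂, h + k, h' + k', ?_, ?_, ?_⟩
    · exact (MeasureTheory.Lp.coeFn_add h k).trans (hh.add hk)
    · refine ⟨fun t => u t + v t, hu.add hv, by simp [hu0, hv0], by simp [hu1, hv1], ?_⟩
      intro t ht
      obtain ⟨a, ha⟩ := hud t ht
      obtain ⟨b, hb⟩ := hvd t ht
      refine ⟨Chat.domain.add_mem a b, ?_⟩
      have e : Chat ⟨u t + v t, Chat.domain.add_mem a b⟩ = Chat ⟨u t, a⟩ + Chat ⟨v t, b⟩ :=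
        Chat.map_add ⟨u t, a⟩ ⟨v t, b⟩
      rw [e, neg_add]
      exact ha.add hb
    · exact (MeasureTheory.Lp.coeFn_add h' k').trans (hh'.add hk')
  smul_mem' := by
    rintro c ⟨Φ, W⟩ ⟨hW, h, h', hh, ⟨u, hu, hu0, hu1, hud⟩, hh'⟩
    refine ⟨HolCyl.smul_mem c hW, c • h, c • h', ?_, ?_, ?_⟩
    · exact (MeasureTheory.Lp.coeFn_smul c h).trans (hh.const_smul c)
    · refine ⟨fun t => c • u t, hu.const_smul c, by simp [hu0], by simp [hu1], ?_⟩
      intro t ht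
      obtain ⟨a, ha⟩ := hud t ht
      refine ⟨Chat.domain.smul_mem c a, ?_⟩
      have e : Chat ⟨c • u t, Chat.domain.smul_mem c a⟩ = c • Chat ⟨u t, a⟩ :=
        Chat.map_smul c ⟨u t, a⟩
      rw [e, ← smul_neg]
      exact ha.const_smul c
    · exact (MeasureTheory.Lp.coeFn_smul c h').trans (hh'.const_smul c)

/-- Given the graph `U` of a transform to functions on `X`, the graph of the operator that acts in
this representation as multiplication by `F`, on its natural domain. -/
def mulGraph {V X : Type} [AddCommGroup V] [Module ℂ V] (U : Submodule ℂ (V × (X → ℂ)))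
    (F : X → ℂ) : Submodule ℂ (V × V) where
  carrier := {q | ∃ W, (q.1, W) ∈ U ∧ (q.2, F * W) ∈ U}
  zero_mem' := ⟨0, U.zero_mem, by rw [mul_zero]; exact U.zero_mem⟩
  add_mem' := by
    rintro p q ⟨W, h1, h2⟩ ⟨W', h1', h2'⟩
    exact ⟨W + W', U.add_mem h1 h1', by rw [mul_add]; exact U.add_mem h2 h2'⟩
  smul_mem' := by
    rintro c p ⟨W, h1, h2⟩
    exact ⟨c • W, U.smul_mem c h1, by rw [mul_smul_comm]; exact U.smul_mem c h2⟩

/-- The operator `F(𝔷̂)` on `Cyl`: `U (F(𝔷̂) Φ) = F · U Φ`. -/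
def quantized (μ : MeasureTheory.Measure (GenConn SU2)) (Chat : Hilb μ →ₗ.[ℂ] Hilb μ)
    (F : GenConn SL2 → ℂ) : Cyl →ₗ.[ℂ] Cyl :=
  (mulGraph (holTransform μ Chat) F).toLinearPMap

/-! ### The homogeneous isotropic sector -/

/-- Invariance of a connection under the Euclidean group, which acts through the diffeomorphisms
`y ↦ r y + x` combined with the constant gauge rotation `r`. -/
def IsEuclideanInvariant (A : RealForm) : Prop :=
  ∀ r : Space ≃ₗᵢ[ℝ] Space, LinearMap.det (r.toLinearEquiv : Space →ₗ[ℝ] Space) = 1 →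
    ∀ x y v : Space, A (r y + x) (r v) = r (A y v)

/-- The connection `c Å` for complex `c`, as a one-form. -/
def scaledForm (A₀ : SmoothConn) (c : ℂ) : ComplexForm := fun x => c • toComplexForm A₀.1 x

/-- The map `r : c ↦ c Å`, through holonomies. -/
def symmConn (A₀ : SmoothConn) (c : ℝ) : GenConn SU2 :=
  holonomies one_mem_SU2 (scaledForm A₀ c)

/-- Cylindrical functions of loop quantum cosmology: the pull-backs under `r` of the cylindrical
functions based on straight edges. -/
def CylS (A₀ : SmoothConn) : Submodule ℂ (ℝ → ℂ) :=
  Cyl.map (LinearMap.funLeft ℂ ℂ (symmConn A₀))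

/-- The reference triad `e` with `e^a_i Å^j_a = ℓ⁻¹ δ^j_i`. -/
def refTriad (ℓ : ℝ) (A₀ : SmoothConn) : RealForm := fun x => ℓ⁻¹ • (A₀.1 x).inverse

/-- Square root of the determinant of the metric whose orthonormal frame is `refTriad`; its
co-triad is `ℓ Å`. -/
def refSqrtDet (ℓ : ℝ) (A₀ : SmoothConn) (x : Space) : ℝ :=
  |LinearMap.det ((ℓ • A₀.1 x : Space →L[ℝ] Space) : Space →ₗ[ℝ] Space)|

/-- The symmetric densitized triad `p ℓ⁻² √q e^a_i`; it maps the index `i` to the index `a`. -/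
def symmTriad (ℓ : ℝ) (A₀ : SmoothConn) (p : ℝ) : RealForm := fun x =>
  (p * (ℓ ^ 2)⁻¹ * refSqrtDet ℓ A₀ x) • refTriad ℓ A₀ x

/-- The smooth one-form `η` is the functional derivative of `C` at the densitized triad `E`:
`d/dt C(E + t h) = ∫ η^i_a h^a_i` at `t = 0` for smooth compactly supported `h`. -/
def HasFunctionalDeriv (C : RealForm → ℝ) (E : RealForm) (η : SmoothConn) : Prop :=
  ∀ h : RealForm, ContDiff ℝ ∞ h → HasCompactSupport h →
    HasDerivAt (fun t : ℝ => C (E + t • h))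
      (∫ x, LinearMap.trace ℝ Space (((η.1 x).comp (h x) : Space →L[ℝ] Space) : Space →ₗ[ℝ] Space))
      0

/-- The complex coordinate `z = c - i (k γ / 3) C_S'(p)`, `k = 8 π G`, generated by the pure
momentum complexifier `C_S(p)`: complex conjugate of `∑ (iⁿ/n!) {c, C_S}_(n)`, where
`{c, p} = k γ / 3` and the terms with `n ≥ 2` vanish. -/
def zCoord (G γ : ℝ) (CS : ℝ → ℝ) (c p : ℝ) : ℂ :=
  c - Complex.I * (8 * Real.pi * G * γ / 3 * deriv CS p : ℝ)

/-- The complex connection `𝔷 = A - i k γ δC/δE`, `k = 8 π G`, generated by a pure momentum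
complexifier `C(E)`, at the symmetric point with connection `c Å` and `δC/δE = η`: complex
conjugate of `∑ (iⁿ/n!) {A, C}_(n)`, where `{A, E} = k γ δ` and the terms with `n ≥ 2` vanish. -/
def complexConn (G γ : ℝ) (A₀ : SmoothConn) (c : ℝ) (η : SmoothConn) : ComplexForm := fun x =>
  scaledForm A₀ c x - (Complex.I * (8 * Real.pi * G * γ : ℝ)) • toComplexForm η.1 x

/-- A map `s : ℂ → 𝒜^ℂ` is holomorphic: so are all its components at all points of space. -/
def IsHolomorphicMap (s : ℂ → SmoothConnC) : Prop :=
  ∀ (x v : Space) (i : Fin 3), Differentiable ℂ fun z => (s z).1 x v i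

/-! ### Holomorphic representation of loop quantum cosmology -/

/-- `a` is the coefficient of `φ` along `e^{iμc/2}`, i.e. the scalar product `⟨e^{iμc/2}, φ⟩` in
`L²` of the Bohr compactification of the line, given by the mean value over the line. -/
def IsBohrCoeff (φ : ℝ → ℂ) (μ : ℝ) (a : ℂ) : Prop :=
  (∀ T : ℝ, IntervalIntegrable φ MeasureTheory.volume (-T) T) ∧
  Filter.Tendsto (fun T : ℝ => ((2 * T : ℝ) : ℂ)⁻¹ *
    ∫ c in (-T)..T, Complex.exp (-(Complex.I * μ * c / 2)) * φ c) Filter.atTop (nhds a)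

lemma IsBohrCoeff.add {φ ψ : ℝ → ℂ} {μ : ℝ} {a b : ℂ}
    (ha : IsBohrCoeff φ μ a) (hb : IsBohrCoeff ψ μ b) : IsBohrCoeff (φ + ψ) μ (a + b) := by
  refine ⟨fun T => (ha.1 T).add (hb.1 T), (Filter.Tendsto.add ha.2 hb.2).congr fun T => ?_⟩
  rw [← mul_add, ← intervalIntegral.integral_add]
  · congr 2; ext c; simp [mul_add]
  · exact (ha.1 T).continuousOn_mul (Continuous.continuousOn (by fun_prop))
  · exact (hb.1 T).continuousOn_mul (Continuous.continuousOn (by fun_prop))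

lemma IsBohrCoeff.smul {φ : ℝ → ℂ} {μ : ℝ} {a : ℂ} (k : ℂ) (ha : IsBohrCoeff φ μ a) :
    IsBohrCoeff (k • φ) μ (k * a) := by
  refine ⟨fun T => (ha.1 T).smul k, (Filter.Tendsto.const_mul k ha.2).congr fun T => ?_⟩
  rw [mul_left_comm, ← intervalIntegral.integral_const_mul]
  congr 2; ext c; simp [mul_left_comm]

lemma isBohrCoeff_zero (μ : ℝ) : IsBohrCoeff 0 μ 0 :=
  ⟨fun _ => intervalIntegrable_const, by simp⟩

/-- `φ' = e^{-Ĉ_S} φ` for `Ĉ_S = C_S(p̂)`. The operator `p̂` acts as `-i (8πγG/3) d/dc`, so the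
orthonormal basis vector `e^{iμc/2}` is an eigenvector with eigenvalue `(8πγG/3) (μ/2)`. -/
def IsExpNegS (G γ : ℝ) (CS : ℝ → ℝ) (φ φ' : ℝ → ℂ) : Prop :=
  ∀ μ : ℝ, ∃ a : ℂ, IsBohrCoeff φ μ a ∧
    IsBohrCoeff φ' μ ((Real.exp (-CS (8 * Real.pi * γ * G / 3 * (μ / 2))) : ℝ) * a)

/-- The graph of the transform `U_S` to the holomorphic representation: `(φ, w)` belongs to it
when `w` is the entire function that extends `e^{-Ĉ_S} φ` analytically. -/
def holTransformS (G γ : ℝ) (A₀ : SmoothConn) (CS : ℝ → ℝ) :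
    Submodule ℂ (CylS A₀ × (ℂ → ℂ)) where
  carrier := {q | Differentiable ℂ q.2 ∧ (fun c : ℝ => q.2 c) ∈ CylS A₀ ∧
    IsExpNegS G γ CS (q.1 : ℝ → ℂ) fun c : ℝ => q.2 c}
  zero_mem' := by
    refine ⟨differentiable_const 0, (CylS A₀).zero_mem, fun μ => ⟨0, isBohrCoeff_zero μ, ?_⟩⟩
    rw [mul_zero]
    exact isBohrCoeff_zero μ
  add_mem' := by
    rintro p q ⟨h1, h2, h3⟩ ⟨k1, k2, k3⟩
    refine ⟨h1.add k1, (CylS A₀).add_mem h2 k2, fun μ => ?_⟩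
    obtain ⟨a, ha, ha'⟩ := h3 μ
    obtain ⟨b, hb, hb'⟩ := k3 μ
    refine ⟨a + b, ha.add hb, ?_⟩
    rw [mul_add]
    exact ha'.add hb'
  smul_mem' := by
    rintro k p ⟨h1, h2, h3⟩
    refine ⟨h1.const_smul k, (CylS A₀).smul_mem k h2, fun μ => ?_⟩
    obtain ⟨a, ha, ha'⟩ := h3 μ
    refine ⟨k * a, ha.smul k, ?_⟩
    rw [mul_left_comm]
    exact ha'.smul k

/-- The holomorphic functions of `z` that depend on `z` via finitely many `z(μ) = e^{iμz/2}`. -/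
def IsHolCylS (w : ℂ → ℂ) : Prop :=
  ∃ (n : ℕ) (μ : Fin n → ℝ) (f : (Fin n → ℂ) → ℂ), DifferentiableOn ℂ f {ζ | ∀ j, ζ j ≠ 0} ∧
    ∀ z, w z = f fun j => Complex.exp (Complex.I * μ j * z / 2)

/-- The operator `w(ẑ)` on `Cyl_S`: `U_S (w(ẑ) φ) = w · U_S φ`. -/
def quantizedS (G γ : ℝ) (A₀ : SmoothConn) (CS : ℝ → ℝ) (w : ℂ → ℂ) :
    CylS A₀ →ₗ.[ℂ] CylS A₀ :=
  (mulGraph (holTransformS G γ A₀ CS) w).toLinearPMap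

/-! ### The `b`-embedding -/

/-- The map `s`, through holonomies. -/
def viaHolonomies (s : ℂ → SmoothConnC) (z : ℂ) : GenConn SL2 := holonomies one_mem_SL2 (s z).1

/-- The graph of `π = U_S⁻¹ ∘ s^* ∘ U` on its natural domain. -/
def bProjGraph (G γ : ℝ) (A₀ : SmoothConn) (μ : MeasureTheory.Measure (GenConn SU2))
    (Chat : Hilb μ →ₗ.[ℂ] Hilb μ) (CS : ℝ → ℝ) (s : ℂ → SmoothConnC) :
    Submodule ℂ (Cyl × CylS A₀) where
  carrier := {q | ∃ W, (q.1, W) ∈ holTransform μ Chat ∧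
    (q.2, W ∘ viaHolonomies s) ∈ holTransformS G γ A₀ CS}
  zero_mem' := ⟨0, (holTransform μ Chat).zero_mem, (holTransformS G γ A₀ CS).zero_mem⟩
  add_mem' := by
    rintro p q ⟨W, h1, h2⟩ ⟨W', h1', h2'⟩
    exact ⟨W + W', (holTransform μ Chat).add_mem h1 h1', (holTransformS G γ A₀ CS).add_mem h2 h2'⟩
  smul_mem' := by
    rintro c p ⟨W, h1, h2⟩
    exact ⟨c • W, (holTransform μ Chat).smul_mem c h1, (holTransformS G γ A₀ CS).smul_mem c h2⟩

/-- The projector `π = U_S⁻¹ ∘ s^* ∘ U` from `Cyl` to `Cyl_S`. -/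
def bProj (G γ : ℝ) (A₀ : SmoothConn) (μ : MeasureTheory.Measure (GenConn SU2))
    (Chat : Hilb μ →ₗ.[ℂ] Hilb μ) (CS : ℝ → ℝ) (s : ℂ → SmoothConnC) : Cyl →ₗ.[ℂ] CylS A₀ :=
  (bProjGraph G γ A₀ μ Chat CS s).toLinearPMap

/-- The dual action `Λ ↦ Λ ∘ T` of a partially defined linear map on (partially defined) linear
functionals, with the natural domain `{v ∈ dom T | T v ∈ dom Λ}`. -/
def dualAct {V W : Type} [AddCommGroup V] [Module ℂ V] [AddCommGroup W] [Module ℂ W]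
    (T : V →ₗ.[ℂ] W) (Λ : W →ₗ.[ℂ] ℂ) : V →ₗ.[ℂ] ℂ where
  domain := (Λ.domain.comap T.toFun).map T.domain.subtype
  toFun :=
    { toFun := fun v => Λ ⟨T ⟨v, by obtain ⟨x, -, h⟩ := v.2; rw [← h]; exact x.2⟩, by
        obtain ⟨v, x, hx, rfl⟩ := v; exact hx⟩
      map_add' := fun v w => by
        rw [← Λ.map_add]; congr 1; ext1; exact T.map_add ⟨v, _⟩ ⟨w, _⟩
      map_smul' := fun c v => by
        rw [RingHom.id_apply, ← Λ.map_smul]; congr 1; ext1; exact T.map_smul c ⟨v, _⟩ }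

/-- The `b`-embedding `ι_b`, `(ι_b ψ)(Φ) = ψ(π Φ)`. -/
def bEmbed (G γ : ℝ) (A₀ : SmoothConn) (μ : MeasureTheory.Measure (GenConn SU2))
    (Chat : Hilb μ →ₗ.[ℂ] Hilb μ) (CS : ℝ → ℝ) (s : ℂ → SmoothConnC)
    (ψ : CylS A₀ →ₗ.[ℂ] ℂ) : Cyl →ₗ.[ℂ] ℂ :=
  dualAct (bProj G γ A₀ μ Chat CS s) ψ

/-- Polynomials in the matrix entries of finitely many holonomies along straight edges. -/
def IsPolyCyl (W : GenConn SL2 → ℂ) : Prop :=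
  ∃ (n : ℕ) (e : Fin n → StraightEdge) (P : MvPolynomial (Fin n × Fin 2 × Fin 2) ℂ),
    ∀ A, W A = MvPolynomial.eval (fun k => A.toFun (e k.1).toCurve k.2.1 k.2.2) P

end

end LoopQG

open LoopQG

/-!
An invariant connection is `A₀ = a dx` with a constant `a`, so the holonomy of `c A₀` along a
straight edge is a rotation about the direction of the edge, a Laurent polynomial in `e^{iνc/2}`,
with `ν` equal to `a` times the length of the edge. At `p = 0` the derivatives of the
complexifiers vanish, so the holomorphic map `s` agrees with `c ↦ c A₀` on the real line, and
hence everywhere: pull-backs of holomorphic cylindrical functions along `s` are holomorphic in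
finitely many exponentials.

The operators are single-valued because both transforms are injective and single-valued. In the
full theory this rests on the injectivity of the heat flow of a symmetric operator, and on the
fact that a holomorphic function on `SL(2,ℂ)ⁿ` vanishing on `SU(2)ⁿ` is zero (Weyl's unitary
trick): a cylindrical function is first rewritten over the edges of a graph, along which the
holonomies of generalized connections are dense in `SU(2)ⁿ`. In the symmetric sector it is the
uniqueness theorem for almost periodic functions, which here are continuous functions on a torus
along a line. The intertwining property is then the identity `(F W) ∘ s = (F ∘ s) (W ∘ s)`.
-/

namespace LoopQG

noncomputable section

attribute [local instance] Matrix.normedAddCommGroup Matrix.normedSpace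

/-! ### Linear differential equations -/

section ODE

variable {E : Type*} [NormedAddCommGroup E] [NormedSpace ℝ E]

lemma eqOn_const_of_hasDerivAt_zero [CompleteSpace E] {f : ℝ → E} {a b : ℝ}
    (hf : ContinuousOn f (Set.Icc a b)) {P : Set ℝ} (hP : P.Countable)
    (hd : ∀ t ∈ Set.Ioo a b \ P, HasDerivAt f 0 t) {t : ℝ} (ht : t ∈ Set.Icc a b) :
    f t = f a := by
  have h := MeasureTheory.integral_eq_of_hasDerivAt_off_countable_of_le f (fun _ => 0) ht.1
    hP (hf.mono (Set.Icc_subset_Icc_right ht.2))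
    (fun x hx => hd x ⟨⟨hx.1.1, hx.1.2.trans_le ht.2⟩, hx.2⟩) intervalIntegrable_const
  exact sub_eq_zero.mp (by simpa only [intervalIntegral.integral_zero] using h.symm)

/-- `u` is a continuous solution of `u' = f(t, u)` on `[a, b]` in the sense suited to piecewise
smooth data: the equation may fail at finitely many times. -/
def IsSolOn (f : ℝ → E → E) (a b : ℝ) (u : ℝ → E) : Prop :=
  ContinuousOn u (Set.Icc a b) ∧
    ∃ P : Set ℝ, P.Finite ∧ ∀ t ∈ Set.Ioo a b \ P, HasDerivAt u (f t (u t)) t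

variable {f : ℝ → E → E} {a b c : ℝ} {u v : ℝ → E}

lemma isSolOn_const_of_self : IsSolOn f a a fun _ => v a :=
  ⟨continuousOn_const, ∅, Set.finite_empty, fun t ht => by simp at ht⟩

lemma IsSolOn.congr {g : ℝ → E → E} (hu : IsSolOn f a b u)
    (h : ∀ t ∈ Set.Ioo a b, f t (u t) = g t (u t)) : IsSolOn g a b u := by
  obtain ⟨hc, P, hP, hd⟩ := hu
  exact ⟨hc, P, hP, fun t ht => h t ht.1 ▸ hd t ht⟩

lemma IsSolOn.glue (hab : a ≤ b) (hbc : b ≤ c) (hu : IsSolOn f a b u) (hv : IsSolOn f b c v)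
    (huv : u b = v b) : IsSolOn f a c fun t => if t ≤ b then u t else v t := by
  obtain ⟨hcu, P, hP, hdu⟩ := hu
  obtain ⟨hcv, Q, hQ, hdv⟩ := hv
  refine ⟨?_, insert b (P ∪ Q), (hP.union hQ).insert b, ?_⟩
  · rw [← Set.Icc_union_Icc_eq_Icc hab hbc]
    refine ContinuousOn.union_of_isClosed ?_ ?_ isClosed_Icc isClosed_Icc
    · exact hcu.congr fun t ht => if_pos ht.2
    · refine hcv.congr fun t ht => ?_
      rcases ht.1.eq_or_lt with rfl | h
      · simpa only [le_refl, if_true] using huv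
      · exact if_neg (not_le.mpr h)
  · rintro t ⟨ht, hn⟩
    simp only [Set.mem_insert_iff, Set.mem_union, not_or] at hn
    rcases lt_or_gt_of_ne hn.1 with h | h
    · simp only [h.le, if_true]
      refine (hdu t ⟨⟨ht.1, h⟩, hn.2.1⟩).congr_of_eventuallyEq ?_
      filter_upwards [eventually_lt_nhds h] with x hx using if_pos hx.le
    · simp only [not_le.mpr h, if_false]
      refine (hdv t ⟨⟨h, ht.2⟩, hn.2.2⟩).congr_of_eventuallyEq ?_
      filter_upwards [eventually_gt_nhds h] with x hx using if_neg (not_le.mpr hx)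

variable [CompleteSpace E] {A : ℝ → E →L[ℝ] E}

lemma exists_isSolOn_of_mul_le_half (hab : a ≤ b) (hA : ContinuousOn A (Set.Icc a b)) {K : ℝ}
    (hK : ∀ t ∈ Set.Icc a b, ‖A t‖ ≤ K) (hKab : K * (b - a) ≤ 1 / 2) (x : E) :
    ∃ u, IsSolOn (fun t => A t) a b u ∧ u a = x := by
  have hK0 : 0 ≤ K := (norm_nonneg _).trans (hK a (Set.left_mem_Icc.mpr hab))
  have hPL : IsPicardLindelof (fun t y => A t y) ⟨a, Set.left_mem_Icc.mpr hab⟩ x (‖x‖₊ + 1) 0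
      (⟨K, hK0⟩ * (2 * ‖x‖₊ + 1)) ⟨K, hK0⟩ := by
    refine ⟨fun t ht => ((A t).lipschitz.weaken (hK t ht)).lipschitzOnWith,
      fun y _ => hA.clm_apply continuousOn_const, fun t ht y hy => ?_, ?_⟩
    · have hy' : ‖y‖ ≤ 2 * ‖x‖ + 1 := by
        have : ‖y - x‖ ≤ ‖x‖ + 1 := by simpa [dist_eq_norm] using hy
        linarith [norm_le_insert' y x]
      exact ((A t).le_opNorm y).trans (mul_le_mul (hK t ht) hy' (norm_nonneg _) hK0)
    · have hba : max (b - a) (a - a) = b - a := max_eq_left (by linarith)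
      have : K * (2 * ‖x‖ + 1) * (b - a) ≤ ‖x‖ + 1 := by
        nlinarith [norm_nonneg x]
      change K * (2 * ‖x‖ + 1) * max (b - a) (a - a) ≤ ‖x‖ + 1 - 0
      rwa [hba, sub_zero]
  obtain ⟨u, hua, hu⟩ := hPL.exists_eq_forall_mem_Icc_hasDerivWithinAt₀
  refine ⟨u, ⟨fun t ht => (hu t ht).continuousWithinAt, ∅, Set.finite_empty, fun t ht => ?_⟩, hua⟩
  exact (hu t (Set.Ioo_subset_Icc_self ht.1)).hasDerivAt (Icc_mem_nhds ht.1.1 ht.1.2)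

lemma exists_isSolOn_of_continuousOn (hab : a ≤ b) (hA : ContinuousOn A (Set.Icc a b)) (x : E) :
    ∃ u, IsSolOn (fun t => A t) a b u ∧ u a = x := by
  obtain ⟨K, hK⟩ := isCompact_Icc.exists_bound_of_continuousOn hA
  obtain ⟨N, hN⟩ := exists_nat_gt (2 * (K * (b - a)))
  have hK0 : 0 ≤ K := (norm_nonneg _).trans (hK a (Set.left_mem_Icc.mpr hab))
  have hN0 : (0 : ℝ) < N := lt_of_le_of_lt (by nlinarith) hN
  set h := (b - a) / N
  have hh0 : 0 ≤ h := div_nonneg (sub_nonneg.mpr hab) hN0.le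
  have hNh : N * h = b - a := mul_div_cancel₀ _ hN0.ne'
  suffices key : ∀ n ≤ N, ∃ u, IsSolOn (fun t => A t) a (a + n * h) u ∧ u a = x by
    simpa [hNh] using key N le_rfl
  intro n
  induction n with
  | zero => exact fun _ => ⟨fun _ => x, by simpa using isSolOn_const_of_self (v := fun _ => x), rfl⟩
  | succ n ih =>
    intro hn
    obtain ⟨u, hu, hua⟩ := ih (by omega)
    have hn' : ((n + 1 : ℕ) : ℝ) * h ≤ b - a :=
      hNh ▸ mul_le_mul_of_nonneg_right (by exact_mod_cast hn) hh0
    have hnh : 0 ≤ n * h := by positivity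
    push_cast at hn' ⊢
    have hsub : Set.Icc (a + n * h) (a + (n + 1) * h) ⊆ Set.Icc a b :=
      Set.Icc_subset_Icc (by linarith) (by linarith)
    obtain ⟨v, hv, hvn⟩ := exists_isSolOn_of_mul_le_half (by linarith) (hA.mono hsub)
      (fun t ht => hK t (hsub ht)) (by nlinarith) (u (a + n * h))
    exact ⟨_, hu.glue (by linarith) (by linarith) hv hvn.symm, by simp [hnh, hua]⟩

end ODE

/-! ### Linear matrix differential equations -/

section Matrix

lemma continuousOn_matrix_mul {X R l m n : Type*} [TopologicalSpace X] [TopologicalSpace R]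
    [NonUnitalNonAssocSemiring R] [ContinuousAdd R] [ContinuousMul R] [Fintype m] {s : Set X}
    {u : X → Matrix l m R} {v : X → Matrix m n R} (hu : ContinuousOn u s)
    (hv : ContinuousOn v s) : ContinuousOn (fun x => u x * v x) s :=
  (continuous_fst.matrix_mul continuous_snd).comp_continuousOn (hu.prodMk hv)

variable {n : Type*} [Fintype n]

/-- Matrix multiplication as a continuous bilinear map, for differentiating products: the
entrywise norm on matrices is not submultiplicative. -/
def mulCLM (n : Type*) [Fintype n] :
    Matrix n n ℂ →L[ℝ] Matrix n n ℂ →L[ℝ] Matrix n n ℂ :=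
  (LinearMap.mul ℝ (Matrix n n ℂ)).toContinuousBilinearMap

lemma hasDerivAt_matrix_mul {u v : ℝ → Matrix n n ℂ} {U V : Matrix n n ℂ} {t : ℝ}
    (hu : HasDerivAt u U t) (hv : HasDerivAt v V t) :
    HasDerivAt (fun x => u x * v x) (U * v t + u t * V) t :=
  ((mulCLM n).hasDerivAt_of_bilinear (fun _ => hu) (fun _ => hv)).congr_deriv (add_comm _ _)

lemma hasDerivAt_adjugate_fin_two {u : ℝ → Mat} {U : Mat} {t : ℝ} (hu : HasDerivAt u U t) :
    HasDerivAt (fun x => (u x).adjugate) U.adjugate t := by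
  have entry : ∀ i j, HasDerivAt (fun x => u x i j) (U i j) t := fun i j =>
    hasDerivAt_pi.mp (hasDerivAt_pi.mp hu i) j
  refine hasDerivAt_pi.mpr fun i => hasDerivAt_pi.mpr fun j => ?_
  fin_cases i <;> fin_cases j <;> simp only [Matrix.adjugate_fin_two]
  · exact entry 1 1
  · exact (entry 0 1).neg
  · exact (entry 1 0).neg
  · exact entry 0 0

lemma adjugate_fin_two_of_trace_eq_zero {R : Type*} [CommRing R] {M : Matrix (Fin 2) (Fin 2) R}
    (h : M.trace = 0) : M.adjugate = -M := by
  rw [Matrix.trace_fin_two] at h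
  rw [Matrix.adjugate_fin_two]
  ext i j
  fin_cases i <;> fin_cases j <;> simp <;> linear_combination h

lemma exists_isSolOn_matrix {M : ℝ → Matrix n n ℂ} {a b : ℝ} (hab : a ≤ b)
    (hM : ContinuousOn M (Set.Icc a b)) (x : Matrix n n ℂ) :
    ∃ u, IsSolOn (fun t g => M t * g) a b u ∧ u a = x :=
  exists_isSolOn_of_continuousOn hab ((mulCLM n).continuous.comp_continuousOn hM) x

lemma IsSolOn.mul_const {M : ℝ → Matrix n n ℂ} {a b : ℝ} {u : ℝ → Matrix n n ℂ}
    (hu : IsSolOn (fun t g => M t * g) a b u) (B : Matrix n n ℂ) :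
    IsSolOn (fun t g => M t * g) a b fun t => u t * B := by
  obtain ⟨hc, P, hP, hd⟩ := hu
  refine ⟨continuousOn_matrix_mul hc continuousOn_const, P, hP, fun t ht => ?_⟩
  refine (hasDerivAt_matrix_mul (hd t ht) (hasDerivAt_const t B)).congr_deriv ?_
  rw [mul_zero, add_zero, Matrix.mul_assoc]

lemma IsSolOn.conjTranspose_mul_self {M : ℝ → Matrix n n ℂ}
    (hM : ∀ t, (M t).conjTranspose = -M t) {a b : ℝ} {u : ℝ → Matrix n n ℂ}
    (hu : IsSolOn (fun t g => M t * g) a b u) {t : ℝ} (ht : t ∈ Set.Icc a b) :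
    (u t).conjTranspose * u t = (u a).conjTranspose * u a := by
  obtain ⟨hc, P, hP, hd⟩ := hu
  refine eqOn_const_of_hasDerivAt_zero
    (continuousOn_matrix_mul (continuous_id.matrix_conjTranspose.comp_continuousOn hc) hc)
    hP.countable (fun x hx => ?_) ht
  refine (hasDerivAt_matrix_mul (hd x hx).star (hd x hx)).congr_deriv ?_
  have hMx : star (M x) = -M x := hM x
  simp [hMx, Matrix.mul_assoc]

section Traceless

variable {M : ℝ → Mat} {a b t : ℝ} {u v : ℝ → Mat}

lemma IsSolOn.adjugate_mul (hM : ∀ t, (M t).trace = 0)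
    (hu : IsSolOn (fun t g => M t * g) a b u) (hv : IsSolOn (fun t g => M t * g) a b v)
    (ht : t ∈ Set.Icc a b) : (u t).adjugate * v t = (u a).adjugate * v a := by
  obtain ⟨hcu, P, hP, hdu⟩ := hu
  obtain ⟨hcv, Q, hQ, hdv⟩ := hv
  have hc : ContinuousOn (fun t => (u t).adjugate * v t) (Set.Icc a b) :=
    continuousOn_matrix_mul (continuous_id.matrix_adjugate.comp_continuousOn hcu) hcv
  refine eqOn_const_of_hasDerivAt_zero (E := Mat) hc (hP.union hQ).countable (fun x hx => ?_) ht
  have hux := hdu x ⟨hx.1, fun h => hx.2 (Or.inl h)⟩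
  have hvx := hdv x ⟨hx.1, fun h => hx.2 (Or.inr h)⟩
  refine (hasDerivAt_matrix_mul (hasDerivAt_adjugate_fin_two hux) hvx).congr_deriv ?_
  rw [Matrix.adjugate_mul_distrib, adjugate_fin_two_of_trace_eq_zero (hM x)]
  simp [Matrix.mul_assoc]

lemma IsSolOn.det_eq_one (hM : ∀ t, (M t).trace = 0)
    (hu : IsSolOn (fun t g => M t * g) a b u) (hua : u a = 1) (ht : t ∈ Set.Icc a b) :
    (u t).det = 1 := by
  have h := IsSolOn.adjugate_mul hM hu hu ht
  rw [Matrix.adjugate_mul, hua, Matrix.adjugate_one, one_mul] at h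
  simpa using congrFun (congrFun h 0) 0

lemma IsSolOn.eq_of_trace_eq_zero (hM : ∀ t, (M t).trace = 0)
    (hu : IsSolOn (fun t g => M t * g) a b u) (hv : IsSolOn (fun t g => M t * g) a b v)
    (hua : u a = 1) (hva : v a = 1) (ht : t ∈ Set.Icc a b) : u t = v t := by
  have h : (u t).adjugate * v t = 1 := by
    rw [IsSolOn.adjugate_mul hM hu hv ht, hua, hva, Matrix.adjugate_one, one_mul]
  calc u t = u t * ((u t).adjugate * v t) := by rw [h, mul_one]
    _ = v t := by
      rw [← Matrix.mul_assoc, Matrix.mul_adjugate, hu.det_eq_one hM hua ht, one_smul, one_mul]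

end Traceless

end Matrix

/-! ### Holonomies of continuous connections -/

/-- The matrix `Z(v)` at the point `x`. -/
def formMat (Z : ComplexForm) (x v : Space) : Mat := ∑ i, Z x v i • tau i

/-- The coefficient `Z(γ')` of the parallel transport equation. -/
def velMat (Z : ComplexForm) (γ : Curve) (t : ℝ) : Mat := formMat Z (γ.toFun t) (deriv γ.toFun t)

/-- `u` solves the parallel transport equation of `Z` along `γ` on `[a, b]`. -/
def IsTransport (Z : ComplexForm) (γ : Curve) (a b : ℝ) (u : ℝ → Mat) : Prop :=
  IsSolOn (fun t g => velMat Z γ t * g) a b u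

lemma trace_tau (i : Fin 3) : (tau i).trace = 0 := by
  fin_cases i <;> simp [tau, Matrix.trace_fin_two, neg_div]

lemma conjTranspose_tau (i : Fin 3) : (tau i).conjTranspose = -tau i := by
  fin_cases i <;> ext j k <;> fin_cases j <;> fin_cases k <;>
    simp [tau, Complex.ext_iff] <;> norm_num

section Holonomy

variable {Z : ComplexForm}

lemma trace_formMat (x v : Space) : (formMat Z x v).trace = 0 := by
  simp [formMat, Matrix.trace_sum, trace_tau]

lemma conjTranspose_formMat (hZ : ∀ x v i, (Z x v i).im = 0) (x v : Space) :
    (formMat Z x v).conjTranspose = -formMat Z x v := by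
  have hstar : ∀ i, star (Z x v i) = Z x v i := fun i => Complex.conj_eq_iff_im.mpr (hZ x v i)
  simp only [formMat, Matrix.conjTranspose_sum, Matrix.conjTranspose_smul, conjTranspose_tau,
    hstar, smul_neg, Finset.sum_neg_distrib]

lemma formMat_smul (x : Space) (r : ℝ) (v : Space) :
    formMat Z x (r • v) = r • formMat Z x v := by
  simp only [formMat, map_smul, Finset.smul_sum, Pi.smul_apply, smul_assoc]

lemma continuousOn_formMat {X : Type*} [TopologicalSpace X] (hZ : Continuous Z) {s : Set X}
    {x v : X → Space} (hx : ContinuousOn x s) (hv : ContinuousOn v s) :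
    ContinuousOn (fun t => formMat Z (x t) (v t)) s :=
  continuousOn_finsetSum _ fun i _ => ((continuous_apply i).comp_continuousOn
    ((hZ.comp_continuousOn hx).clm_apply hv)).smul continuousOn_const

variable {γ γ' γ₁ γ₂ : Curve} {g g' : Mat}

lemma isHolonomy_iff : IsHolonomy Z γ g ↔ ∃ u, IsTransport Z γ 0 1 u ∧ u 0 = 1 ∧ u 1 = g :=
  ⟨fun ⟨u, hc, h0, h1, hd⟩ => ⟨u, ⟨hc, hd⟩, h0, h1⟩,
    fun ⟨u, ⟨hc, hd⟩, h0, h1⟩ => ⟨u, hc, h0, h1, hd⟩⟩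

lemma IsHolonomy.unique (h : IsHolonomy Z γ g) (h' : IsHolonomy Z γ g') : g = g' := by
  obtain ⟨u, hu, hu0, rfl⟩ := isHolonomy_iff.mp h
  obtain ⟨v, hv, hv0, rfl⟩ := isHolonomy_iff.mp h'
  exact IsSolOn.eq_of_trace_eq_zero (fun t => trace_formMat _ _) hu hv hu0 hv0 (by simp)

lemma IsHolonomy.mem_SL2 (h : IsHolonomy Z γ g) : g ∈ SL2 := by
  obtain ⟨u, hu, hu0, rfl⟩ := isHolonomy_iff.mp h
  exact IsSolOn.det_eq_one (fun t => trace_formMat _ _) hu hu0 (by simp)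

lemma IsHolonomy.mem_SU2 (hZ : ∀ x v i, (Z x v i).im = 0) (h : IsHolonomy Z γ g) : g ∈ SU2 := by
  refine Matrix.mem_specialUnitaryGroup_iff.mpr ⟨?_, h.mem_SL2⟩
  obtain ⟨u, hu, hu0, rfl⟩ := isHolonomy_iff.mp h
  refine Matrix.mem_unitaryGroup_iff'.mpr ((IsSolOn.conjTranspose_mul_self
    (fun t => conjTranspose_formMat hZ _ _) hu (t := 1) (by simp)).trans ?_)
  simp [hu0]

lemma Curve.induction_analyticOn (γ : Curve) {p : ℝ → Prop} (h0 : p 0)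
    (step : ∀ a b, 0 ≤ a → a < b → AnalyticOn ℝ γ.toFun (Set.Icc a b) → p a → p b) : p 1 := by
  obtain ⟨n, t, hmono, ht0, ht1, h⟩ := γ.piecewiseAnalytic
  have key : ∀ i : Fin (n + 1), p (t i) := by
    refine Fin.induction (ht0 ▸ h0) fun i hi => ?_
    exact step _ _ (ht0 ▸ hmono.monotone (Fin.zero_le _)) (hmono i.castSucc_lt_succ) (h i).1 hi
  exact ht1 ▸ key (Fin.last n)

lemma Curve.exists_finite_differentiableAt (γ : Curve) :
    ∃ P : Set ℝ, P.Finite ∧ ∀ t ∈ Set.Ioo (0 : ℝ) 1 \ P, DifferentiableAt ℝ γ.toFun t := by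
  refine γ.induction_analyticOn (p := fun b => ∃ P : Set ℝ, P.Finite ∧
    ∀ t ∈ Set.Ioo 0 b \ P, DifferentiableAt ℝ γ.toFun t) ⟨∅, Set.finite_empty, by simp⟩ ?_
  rintro a b - - hA ⟨P, hP, hd⟩
  refine ⟨insert a P, hP.insert a, fun t ⟨ht, htP⟩ => ?_⟩
  rw [Set.mem_insert_iff, not_or] at htP
  rcases lt_or_gt_of_ne htP.1 with hta | hat
  · exact hd t ⟨⟨ht.1, hta⟩, htP.2⟩
  · exact (hA.differentiableOn t ⟨hat.le, ht.2.le⟩).differentiableAt (Icc_mem_nhds hat ht.2)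

lemma exists_isTransport_of_analyticOn (hZ : Continuous Z) {a b : ℝ} (hab : a < b)
    (hγ : AnalyticOn ℝ γ.toFun (Set.Icc a b)) (x : Mat) :
    ∃ u, IsTransport Z γ a b u ∧ u a = x := by
  have hd := (hγ.contDiffOn (uniqueDiffOn_Icc hab) (n := 1)).continuousOn_derivWithin
    (uniqueDiffOn_Icc hab) le_rfl
  obtain ⟨u, hu, hua⟩ :=
    exists_isSolOn_matrix hab.le (continuousOn_formMat hZ hγ.continuousOn hd) x
  refine ⟨u, hu.congr fun t ht => ?_, hua⟩
  rw [velMat, derivWithin_of_mem_nhds (Icc_mem_nhds ht.1 ht.2)]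

lemma exists_isHolonomy (hZ : Continuous Z) (γ : Curve) : ∃ g, IsHolonomy Z γ g := by
  suffices h : ∃ u, IsTransport Z γ 0 1 u ∧ u 0 = 1 by
    obtain ⟨u, hu, hu0⟩ := h
    exact ⟨u 1, isHolonomy_iff.mpr ⟨u, hu, hu0, rfl⟩⟩
  refine γ.induction_analyticOn (p := fun b => ∃ u, IsTransport Z γ 0 b u ∧ u 0 = 1)
    ⟨fun _ => 1, isSolOn_const_of_self (v := fun _ => 1), rfl⟩ ?_
  rintro a b ha hab hA ⟨u, hu, hu0⟩
  obtain ⟨v, hv, hva⟩ := exists_isTransport_of_analyticOn hZ hab hA (u a)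
  exact ⟨_, hu.glue ha hab.le hv hva.symm, by simp [ha, hu0]⟩

lemma IsTransport.comp {u : ℝ → Mat} (hu : IsTransport Z γ 0 1 u) {a b : ℝ} (hab : a ≠ b)
    {σ : ℝ → ℝ} (hc : ContinuousOn σ (Set.Icc a b))
    (hm : Set.MapsTo σ (Set.Ioo a b) (Set.Ioo 0 1)) (hinj : Set.InjOn σ (Set.Ioo a b))
    {R : Set ℝ} (hR : R.Finite) (hd : ∀ t ∈ Set.Ioo a b \ R, DifferentiableAt ℝ σ t)
    (hγ' : ∀ t ∈ Set.Ioo a b, γ'.toFun t = γ.toFun (σ t)) : IsTransport Z γ' a b (u ∘ σ) := by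
  obtain ⟨huc, P, hP, hud⟩ := hu
  obtain ⟨Q, hQ, hγ⟩ := γ.exists_finite_differentiableAt
  have hm' : Set.MapsTo σ (Set.Icc a b) (Set.Icc 0 1) := by
    have := hm.closure_of_continuousOn ((closure_Ioo hab).symm ▸ hc)
    rwa [closure_Ioo hab, closure_Ioo zero_ne_one] at this
  refine ⟨huc.comp hc hm', R ∪ (Set.Ioo a b ∩ σ ⁻¹' (P ∪ Q)), hR.union ?_, ?_⟩
  · exact Set.Finite.of_finite_image ((hP.union hQ).subset (by
      rintro _ ⟨x, hx, rfl⟩; exact hx.2)) (hinj.mono Set.inter_subset_left)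
  rintro t ⟨ht, htn⟩
  simp only [Set.mem_union, not_or, Set.mem_inter_iff, not_and, Set.mem_preimage] at htn
  obtain ⟨htP, htQ⟩ := htn.2 ht
  have hσ := (hd t ⟨ht, htn.1⟩).hasDerivAt
  have hγt : HasDerivAt γ'.toFun (deriv σ t • deriv γ.toFun (σ t)) t := by
    refine ((hγ _ ⟨hm ht, htQ⟩).hasDerivAt.scomp t hσ).congr_of_eventuallyEq ?_
    filter_upwards [Ioo_mem_nhds ht.1 ht.2] with x hx using hγ' x hx
  refine ((hud _ ⟨hm ht, htP⟩).scomp t hσ).congr_deriv ?_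
  change deriv σ t • (velMat Z γ (σ t) * u (σ t)) = velMat Z γ' t * u (σ t)
  rw [velMat, velMat, hγt.deriv, formMat_smul, hγ' t ht]
  exact (Matrix.smul_mul _ _ _).symm

lemma IsHolonomy.reparam {τ : ℝ → ℝ} (hc : ContinuousOn τ (Set.Icc 0 1))
    (hmono : StrictMonoOn τ (Set.Icc 0 1)) (h0 : τ 0 = 0) (h1 : τ 1 = 1) {P : Set ℝ}
    (hP : P.Finite) (hd : ∀ t ∈ Set.Ioo (0 : ℝ) 1 \ P, DifferentiableAt ℝ τ t)
    (hγ' : ∀ t ∈ Set.Icc (0 : ℝ) 1, γ'.toFun t = γ.toFun (τ t)) (h : IsHolonomy Z γ g) :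
    IsHolonomy Z γ' g := by
  obtain ⟨u, hu, hu0, hu1⟩ := isHolonomy_iff.mp h
  have hm : Set.MapsTo τ (Set.Ioo 0 1) (Set.Ioo 0 1) := fun t ht => by
    have ht' := Set.Ioo_subset_Icc_self ht
    exact ⟨h0 ▸ hmono (by simp) ht' ht.1, h1 ▸ hmono ht' (by simp) ht.2⟩
  exact isHolonomy_iff.mpr ⟨u ∘ τ, hu.comp zero_ne_one hc hm
    (hmono.injOn.mono Set.Ioo_subset_Icc_self) hP hd
    fun t ht => hγ' t (Set.Ioo_subset_Icc_self ht), by simp [h0, hu0], by simp [h1, hu1]⟩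

lemma IsTransport.comp_affine {u : ℝ → Mat} (hu : IsTransport Z γ 0 1 u) {a b k d : ℝ}
    (hab : a ≠ b) (hk : k ≠ 0)
    (hm : Set.MapsTo (fun t => k * t + d) (Set.Ioo a b) (Set.Ioo 0 1))
    (hγ' : ∀ t ∈ Set.Icc a b, γ'.toFun t = γ.toFun (k * t + d)) :
    IsTransport Z γ' a b (u ∘ fun t => k * t + d) :=
  hu.comp hab (by fun_prop) hm (fun x _ y _ hxy => mul_left_cancel₀ hk (add_right_cancel hxy))
    Set.finite_empty (fun t _ => by fun_prop) fun t ht => hγ' t (Set.Ioo_subset_Icc_self ht)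

lemma IsHolonomy.comp {g₁ g₂ : Mat} (h₁ : IsHolonomy Z γ₁ g₁) (h₂ : IsHolonomy Z γ₂ g₂)
    (hγ₁ : ∀ t ∈ Set.Icc (0 : ℝ) (1 / 2), γ.toFun t = γ₁.toFun (2 * t))
    (hγ₂ : ∀ t ∈ Set.Icc (1 / 2 : ℝ) 1, γ.toFun t = γ₂.toFun (2 * t - 1)) :
    IsHolonomy Z γ (g₂ * g₁) := by
  obtain ⟨u, hu, hu0, rfl⟩ := isHolonomy_iff.mp h₁
  obtain ⟨v, hv, hv0, rfl⟩ := isHolonomy_iff.mp h₂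
  have hu' : IsTransport Z γ 0 (1 / 2) (u ∘ fun t => 2 * t + 0) :=
    hu.comp_affine (by norm_num) two_ne_zero
      (fun t ht => ⟨by linarith [ht.1], by linarith [ht.2]⟩) fun t ht => by simp [hγ₁ t ht]
  have hv' : IsTransport Z γ (1 / 2) 1 (v ∘ fun t => 2 * t + -1) :=
    hv.comp_affine (by norm_num) two_ne_zero
      (fun t ht => ⟨by linarith [ht.1], by linarith [ht.2]⟩) hγ₂
  refine isHolonomy_iff.mpr ⟨_, hu'.glue (by norm_num) (by norm_num) (hv'.mul_const (u 1)) ?_,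
    ?_, ?_⟩
  · norm_num [hv0]
  · norm_num [hu0]
  · norm_num

lemma IsHolonomy.mul_eq_one_of_reverse (h : IsHolonomy Z γ g) (h' : IsHolonomy Z γ' g')
    (hγ' : ∀ t ∈ Set.Icc (0 : ℝ) 1, γ'.toFun t = γ.toFun (1 - t)) : g' * g = 1 := by
  have hdet := h.mem_SL2
  obtain ⟨u, hu, hu0, rfl⟩ := isHolonomy_iff.mp h
  obtain ⟨v, hv, hv0, rfl⟩ := isHolonomy_iff.mp h'
  have hu' : IsTransport Z γ' 0 1 (u ∘ fun t => -1 * t + 1) :=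
    hu.comp_affine zero_ne_one (by norm_num)
      (fun t ht => ⟨by linarith [ht.2], by linarith [ht.1]⟩)
      fun t ht => by rw [hγ' t ht]; ring_nf
  have hv1 : v 1 = (u 1).adjugate := by
    simpa [hu0, hv0] using
      IsSolOn.adjugate_mul (fun t => trace_formMat _ _) hu' hv (t := 1) (by simp)
  rw [hv1, Matrix.adjugate_mul, show (u 1).det = 1 from hdet, one_smul]

/-- The generalized connection of the holonomies of a continuous one-form. -/
def holConn (S : Set Mat) (hZ : Continuous Z) (hS : ∀ γ g, IsHolonomy Z γ g → g ∈ S) :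
    GenConn S where
  toFun γ := (exists_isHolonomy hZ γ).choose
  mem γ := hS γ _ (exists_isHolonomy hZ γ).choose_spec
  reparam γ γ' _ hc hmono h0 h1 := fun ⟨_, hP, hd⟩ hγ' =>
    (exists_isHolonomy hZ γ').choose_spec.unique
      ((exists_isHolonomy hZ γ).choose_spec.reparam hc hmono h0 h1 hP hd hγ')
  comp γ₁ γ₂ γ hγ₁ hγ₂ := (exists_isHolonomy hZ γ).choose_spec.unique
    ((exists_isHolonomy hZ γ₁).choose_spec.comp (exists_isHolonomy hZ γ₂).choose_spec hγ₁ hγ₂)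
  inv γ γ' hγ' := (exists_isHolonomy hZ γ).choose_spec.mul_eq_one_of_reverse
    (exists_isHolonomy hZ γ').choose_spec hγ'

lemma isHolonomy_holonomies {S : Set Mat} (h1 : (1 : Mat) ∈ S) (hZ : Continuous Z)
    (hS : ∀ γ g, IsHolonomy Z γ g → g ∈ S) (γ : Curve) :
    IsHolonomy Z γ ((holonomies h1 Z).toFun γ) := by
  have h : ∃ A : GenConn S, ∀ γ, IsHolonomy Z γ (A.toFun γ) :=
    ⟨holConn S hZ hS, fun γ => (exists_isHolonomy hZ γ).choose_spec⟩
  rw [holonomies, dif_pos h]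
  exact h.choose_spec γ

end Holonomy

/-! ### Euclidean invariant connections -/

lemma det_reflection_span_singleton {v : Space} (hv : v ≠ 0) :
    LinearMap.det ((ℝ ∙ v).reflection.toLinearEquiv : Space →ₗ[ℝ] Space) = 1 := by
  have hdim := (ℝ ∙ v).finrank_add_finrank_orthogonal
  rw [finrank_span_singleton hv, finrank_euclideanSpace_fin] at hdim
  have hperp : Module.finrank ℝ (ℝ ∙ v)ᗮ = 2 := by omega
  refine ((ℝ ∙ v).det_reflection).trans ?_
  rw [hperp]
  norm_num

/-- Translations make the connection constant; invariance under the half turn about `v` makes `v`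
an eigenvector of its value. -/
lemma IsEuclideanInvariant.exists_eq_smul {A : RealForm} (h : IsEuclideanInvariant A) :
    ∃ a : ℝ, ∀ x v, A x v = a • v := by
  have hconst : ∀ x v, A x v = A 0 v := fun x v => by
    simpa using h (LinearIsometryEquiv.refl ℝ Space)
      (show LinearMap.det (LinearMap.id : Space →ₗ[ℝ] Space) = 1 from LinearMap.det_id) x 0 v
  have heigen : ∀ v, ¬ LinearIndependent ℝ ![v, (A 0 : Space →ₗ[ℝ] Space) v] := by
    intro v hv
    have hv0 : v ≠ 0 := hv.ne_zero 0
    have hturn := h _ (det_reflection_span_singleton hv0) 0 0 v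
    rw [Submodule.reflection_mem_subspace_eq_self (Submodule.mem_span_singleton_self v), map_zero,
      add_zero] at hturn
    obtain ⟨c, hc⟩ := Submodule.mem_span_singleton.mp
      ((Submodule.reflection_eq_self_iff _).mp hturn.symm)
    have := LinearIndependent.pair_iff.mp hv c (-1) (by simp [hc])
    simp at this
  obtain ⟨a, ha⟩ := LinearMap.exists_eq_smul_id_of_forall_notLinearIndependent heigen
  exact ⟨a, fun x v => (hconst x v).trans (congrArg (fun f : Space →ₗ[ℝ] Space => f v) ha)⟩

lemma eq_of_differentiable_of_eqOn_real {f g : ℂ → ℂ} (hf : Differentiable ℂ f)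
    (hg : Differentiable ℂ g) (h : ∀ c : ℝ, f c = g c) : f = g := by
  refine AnalyticOnNhd.eq_of_frequently_eq (z₀ := 0)
    (fun z _ => hf.analyticAt z) (fun z _ => hg.analyticAt z) ?_
  have ht : Filter.Tendsto (fun c : ℝ => (c : ℂ)) (nhdsWithin 0 {0}ᶜ) (nhdsWithin 0 {0}ᶜ) :=
    tendsto_nhdsWithin_iff.mpr
      ⟨(Complex.continuous_ofReal.tendsto' 0 0 Complex.ofReal_zero).mono_left nhdsWithin_le_nhds,
        by filter_upwards [self_mem_nhdsWithin] with c hc using by simpa using hc⟩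
  exact ht.frequently (Filter.Eventually.of_forall h).frequently

lemma IsHolomorphicMap.eq_scaledForm {A₀ : SmoothConn} {s : ℂ → SmoothConnC}
    (hs : IsHolomorphicMap s) (hreal : ∀ c : ℝ, (s c).1 = scaledForm A₀ c) (z : ℂ) :
    (s z).1 = scaledForm A₀ z := by
  ext x v i
  have hlin : Differentiable ℂ fun z => scaledForm A₀ z x v i := by
    simp only [scaledForm, smul_apply, Pi.smul_apply, smul_eq_mul]
    fun_prop
  exact congrFun (eq_of_differentiable_of_eqOn_real (hs x v i) hlin fun c => by rw [hreal]) z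

/-! ### Holonomies along straight edges -/

/-- The entire functions `e^{iνz/2}`, in terms of which the holonomies of `z Å` along straight
edges are expressed. -/
def expFn (ν : ℝ) (z : ℂ) : ℂ := Complex.exp (Complex.I * ν * z / 2)

lemma expFn_ne_zero (ν : ℝ) (z : ℂ) : expFn ν z ≠ 0 := Complex.exp_ne_zero _

lemma norm_expFn_ofReal (ν c : ℝ) : ‖expFn ν c‖ = 1 := by
  rw [expFn, show Complex.I * ν * c / 2 = (ν * c / 2 : ℝ) * Complex.I by push_cast; ring,
    Complex.norm_exp_ofReal_mul_I]

lemma expFn_zero : expFn 0 = 1 := by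
  funext z
  simp [expFn]

lemma expFn_mul (ν ν' : ℝ) : expFn ν * expFn ν' = expFn (ν + ν') := by
  funext z
  simp only [expFn, Pi.mul_apply, ← Complex.exp_add]
  push_cast
  ring_nf

lemma expFn_neg (ν : ℝ) (z : ℂ) : expFn (-ν) z = (expFn ν z)⁻¹ := by
  simp only [expFn, ← Complex.exp_neg]
  push_cast
  ring_nf

lemma hasDerivAt_expFn (ν : ℝ) (z : ℂ) :
    HasDerivAt (expFn ν) (Complex.I * ν / 2 * expFn ν z) z := by
  have h : HasDerivAt (fun z : ℂ => Complex.I * ν * z / 2) (Complex.I * ν * 1 / 2) z :=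
    ((hasDerivAt_id z).const_mul _).div_const 2
  exact h.cexp.congr_deriv (by rw [expFn]; ring)

lemma differentiable_expFn (ν : ℝ) : Differentiable ℂ (expFn ν) :=
  fun z => (hasDerivAt_expFn ν z).differentiableAt

lemma continuous_expFn_ofReal (ν : ℝ) : Continuous fun c : ℝ => expFn ν c :=
  (differentiable_expFn ν).continuous.comp Complex.continuous_ofReal

/-- The matrix of a vector in the basis `τ_i`. -/
def dirMat (v : Space) : Mat := ∑ i, (v i : ℂ) • tau i

/-- The spectral projection of `dirMat v` for the eigenvalue `i‖v‖/2`; the one for `-i‖v‖/2` is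
`axisProj (-v)`. -/
def axisProj (v : Space) : Mat := (1 / 2 : ℂ) • 1 + (Complex.I * ‖v‖)⁻¹ • dirMat v

/-- The rotation by the (complex) angle `θ` about the axis `v`, as a function of
`ζ = e^{iθ/2}`. -/
def rotMat (v : Space) (ζ : ℂ) : Mat := ζ • axisProj v + ζ⁻¹ • axisProj (-v)

/-- The displacement of a straight edge. -/
def StraightEdge.dir (e : StraightEdge) : Space := e.tgt - e.src

lemma StraightEdge.dir_ne_zero (e : StraightEdge) : e.dir ≠ 0 := sub_ne_zero.mpr e.ne.symm

lemma StraightEdge.deriv_toCurve (e : StraightEdge) (t : ℝ) : deriv e.toCurve.toFun t = e.dir := by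
  have h : HasDerivAt (fun t : ℝ => e.src + t • (e.tgt - e.src)) (e.tgt - e.src) t := by
    simpa using ((hasDerivAt_id t).smul_const (e.tgt - e.src)).const_add e.src
  exact h.deriv

lemma dirMat_eq (v : Space) : dirMat v =
    !![-Complex.I / 2 * v 2, -Complex.I / 2 * v 0 - 1 / 2 * v 1;
      -Complex.I / 2 * v 0 + 1 / 2 * v 1, Complex.I / 2 * v 2] := by
  ext i j
  fin_cases i <;> fin_cases j <;> simp [dirMat, tau, Fin.sum_univ_three] <;> ring

lemma dirMat_neg (v : Space) : dirMat (-v) = -dirMat v := by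
  simp [dirMat]

lemma trace_dirMat (v : Space) : (dirMat v).trace = 0 := by
  simp [dirMat, Matrix.trace_sum, trace_tau]

lemma conjTranspose_dirMat (v : Space) : (dirMat v).conjTranspose = -dirMat v := by
  simp [dirMat, Matrix.conjTranspose_sum, conjTranspose_tau]

lemma norm_sq_eq_sum_coord (v : Space) :
    (‖v‖ : ℂ) ^ 2 = (v 0 : ℂ) ^ 2 + (v 1 : ℂ) ^ 2 + (v 2 : ℂ) ^ 2 := by
  have h := EuclideanSpace.real_norm_sq_eq v
  rw [Fin.sum_univ_three] at h
  exact_mod_cast h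

lemma dirMat_mul_self (v : Space) : dirMat v * dirMat v = (-(‖v‖ : ℂ) ^ 2 / 4) • (1 : Mat) := by
  rw [dirMat_eq, norm_sq_eq_sum_coord]
  ext i j
  fin_cases i <;> fin_cases j <;> simp [Matrix.mul_apply, Fin.sum_univ_two] <;> ring_nf <;>
    simp only [Complex.I_sq] <;> ring

lemma det_smul_one_add_smul_dirMat (x y : ℂ) (v : Space) :
    (x • (1 : Mat) + y • dirMat v).det = x ^ 2 + y ^ 2 * (‖v‖ ^ 2 / 4) := by
  rw [dirMat_eq, Matrix.det_fin_two, norm_sq_eq_sum_coord]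
  simp only [Matrix.add_apply, Matrix.smul_apply, smul_eq_mul, Matrix.of_apply, Matrix.cons_val',
    Matrix.cons_val_zero, Matrix.cons_val_one, Matrix.cons_val_fin_one, Matrix.one_fin_two]
  linear_combination (-(y * v 2) ^ 2 / 4 - (y * v 0) ^ 2 / 4) * Complex.I_sq

lemma axisProj_neg (v : Space) : axisProj (-v) = 1 - axisProj v := by
  rw [axisProj, axisProj, dirMat_neg, norm_neg]
  module

lemma conjTranspose_axisProj (v : Space) : (axisProj v).conjTranspose = axisProj v := by
  have h : star (Complex.I * (‖v‖ : ℂ))⁻¹ = -(Complex.I * ‖v‖)⁻¹ := by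
    simp [mul_comm]
  rw [axisProj, Matrix.conjTranspose_add, Matrix.conjTranspose_smul, Matrix.conjTranspose_smul,
    conjTranspose_dirMat, h, Matrix.conjTranspose_one]
  simp

section RotMat

variable {v : Space} (hv : v ≠ 0)

include hv

lemma dirMat_mul_axisProj : dirMat v * axisProj v = (Complex.I * ‖v‖ / 2) • axisProj v := by
  have hn : (‖v‖ : ℂ) ≠ 0 := by simpa using hv
  rw [axisProj, Matrix.mul_add, Matrix.mul_smul, Matrix.mul_smul, dirMat_mul_self, mul_one,
    smul_add, smul_smul, smul_smul, smul_smul, add_comm]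
  congr 2
  · field_simp
    linear_combination -4 * Complex.I_sq
  · field_simp

lemma axisProj_mul_self : axisProj v * axisProj v = axisProj v := by
  have hn : (‖v‖ : ℂ) ≠ 0 := by simpa using hv
  have hI := Complex.I_ne_zero
  nth_rw 1 [axisProj]
  rw [Matrix.add_mul, Matrix.smul_mul, Matrix.smul_mul, dirMat_mul_axisProj hv, one_mul, smul_smul,
    ← add_smul]
  convert one_smul ℂ _ using 2
  field_simp
  norm_num

lemma trace_axisProj_mul_rotMat (ζ : ℂ) : (axisProj v * rotMat v ζ).trace = ζ := by
  have htr : (axisProj v).trace = 1 := by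
    rw [axisProj, Matrix.trace_add, Matrix.trace_smul, Matrix.trace_smul, trace_dirMat,
      Matrix.trace_one]
    simp
  rw [rotMat, axisProj_neg, Matrix.mul_add, Matrix.mul_smul, Matrix.mul_smul, mul_sub, mul_one,
    axisProj_mul_self hv, sub_self, smul_zero, add_zero, Matrix.trace_smul, htr, smul_eq_mul,
    mul_one]

lemma rotMat_mul (ζ ξ : ℂ) : rotMat v ζ * rotMat v ξ = rotMat v (ζ * ξ) := by
  simp only [rotMat, axisProj_neg, add_mul, mul_add, Matrix.smul_mul, Matrix.mul_smul, sub_mul,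
    mul_sub, one_mul, mul_one, axisProj_mul_self hv, mul_inv]
  module

lemma det_rotMat {ζ : ℂ} (hζ : ζ ≠ 0) : (rotMat v ζ).det = 1 := by
  have hn : (‖v‖ : ℂ) ≠ 0 := by simpa using hv
  have h : rotMat v ζ = ((ζ + ζ⁻¹) / 2) • (1 : Mat) +
      ((ζ - ζ⁻¹) / (Complex.I * ‖v‖)) • dirMat v := by
    rw [rotMat, axisProj_neg, axisProj]
    module
  rw [h, det_smul_one_add_smul_dirMat]
  field_simp
  rw [Complex.I_sq]
  ring

lemma hasDerivAt_rotMat {ζ : ℂ} (hζ : ζ ≠ 0) :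
    HasDerivAt (rotMat v) ((2 / (Complex.I * ‖v‖ * ζ)) • (dirMat v * rotMat v ζ)) ζ := by
  have hn : (‖v‖ : ℂ) ≠ 0 := by simpa using hv
  have hI := Complex.I_ne_zero
  have hneg : dirMat v * axisProj (-v) = -((Complex.I * ‖v‖ / 2) • axisProj (-v)) := by
    rw [← norm_neg v, ← dirMat_mul_axisProj (neg_ne_zero.mpr hv), dirMat_neg, neg_mul, neg_neg]
  refine HasDerivAt.congr_deriv (((hasDerivAt_id ζ).smul_const (axisProj v)).add
    ((hasDerivAt_inv hζ).smul_const (axisProj (-v)))) ?_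
  rw [rotMat, mul_add, Matrix.mul_smul, Matrix.mul_smul, dirMat_mul_axisProj hv, hneg, smul_add,
    smul_neg, smul_neg, smul_smul, smul_smul, smul_smul, smul_smul, ← neg_smul]
  congr 2 <;> field_simp

lemma rotMat_mem_SU2 {ζ : ℂ} (hζ : ‖ζ‖ = 1) : rotMat v ζ ∈ SU2 := by
  have hζ0 : ζ ≠ 0 := norm_ne_zero_iff.mp (hζ ▸ one_ne_zero)
  have hstar : (rotMat v ζ).conjTranspose = rotMat v ζ⁻¹ := by
    simp only [rotMat, Matrix.conjTranspose_add, Matrix.conjTranspose_smul, conjTranspose_axisProj,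
      Complex.inv_eq_conj hζ, ← Complex.star_def, star_star]
    rw [Complex.star_def, ← Complex.inv_eq_conj hζ, inv_inv]
  refine Matrix.mem_specialUnitaryGroup_iff.mpr
    ⟨Matrix.mem_unitaryGroup_iff'.mpr ?_, det_rotMat hv hζ0⟩
  rw [Matrix.star_eq_conjTranspose, hstar, rotMat_mul hv, inv_mul_cancel₀ hζ0, rotMat,
    axisProj_neg]
  simp

end RotMat

section Symmetric

variable {A₀ : SmoothConn} {a : ℝ} (ha : ∀ x v, A₀.1 x v = a • v)

include ha

lemma scaledForm_apply (z : ℂ) (x v : Space) (i : Fin 3) :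
    scaledForm A₀ z x v i = z * a * v i := by
  simp [scaledForm, toComplexForm, ha, mul_assoc]

lemma isHolonomy_scaledForm_toCurve (z : ℂ) (e : StraightEdge) :
    IsHolonomy (scaledForm A₀ z) e.toCurve (rotMat e.dir (expFn (a * ‖e.dir‖) z)) := by
  have hn : (‖e.dir‖ : ℂ) ≠ 0 := by simpa using e.dir_ne_zero
  have hI := Complex.I_ne_zero
  have hvel (t : ℝ) : velMat (scaledForm A₀ z) e.toCurve t = (z * a) • dirMat e.dir := by
    simp only [velMat, formMat, e.deriv_toCurve, scaledForm_apply ha, dirMat, Finset.smul_sum,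
      smul_smul]
  set u : ℝ → Mat := fun t => rotMat e.dir (expFn (a * ‖e.dir‖) (t * z)) with hu
  have hd (t : ℝ) : HasDerivAt u (velMat (scaledForm A₀ z) e.toCurve t * u t) t := by
    have hζ := (hasDerivAt_expFn (a * ‖e.dir‖) (t * z)).comp t
      (Complex.ofRealCLM.hasDerivAt.mul_const z)
    refine ((hasDerivAt_rotMat e.dir_ne_zero (expFn_ne_zero _ _)).scomp t hζ).congr_deriv ?_
    rw [hvel, Matrix.smul_mul, smul_smul]
    have := expFn_ne_zero (a * ‖e.dir‖) (t * z)
    congr 1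
    simp only [Complex.ofRealCLM_apply, Complex.ofReal_one, Complex.ofReal_mul]
    field_simp
  refine isHolonomy_iff.mpr ⟨u, ⟨fun t _ => (hd t).continuousAt.continuousWithinAt, ∅,
    Set.finite_empty, fun t _ => hd t⟩, ?_, by simp [hu]⟩
  simp [hu, expFn, rotMat, axisProj_neg]

lemma continuous_scaledForm (z : ℂ) : Continuous (scaledForm A₀ z) := by
  have h : scaledForm A₀ z = fun _ => scaledForm A₀ z 0 := by
    ext x v i
    simp only [scaledForm_apply ha]
  exact h ▸ continuous_const

lemma symmConn_toCurve (c : ℝ) (e : StraightEdge) :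
    (symmConn A₀ c).toFun e.toCurve = rotMat e.dir (expFn (a * ‖e.dir‖) c) := by
  have hreal : ∀ x v i, (scaledForm A₀ (c : ℂ) x v i).im = 0 := fun x v i => by
    rw [scaledForm_apply ha]
    norm_cast
  exact (isHolonomy_holonomies one_mem_SU2 (continuous_scaledForm ha c)
    (fun γ g hg => hg.mem_SU2 hreal) _).unique (isHolonomy_scaledForm_toCurve ha c e)

lemma viaHolonomies_toCurve {s : ℂ → SmoothConnC} (hs : ∀ z, (s z).1 = scaledForm A₀ z) (z : ℂ)
    (e : StraightEdge) :
    (viaHolonomies s z).toFun e.toCurve = rotMat e.dir (expFn (a * ‖e.dir‖) z) := by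
  rw [viaHolonomies, hs]
  exact (isHolonomy_holonomies one_mem_SL2 (continuous_scaledForm ha z)
    (fun γ g hg => hg.mem_SL2) _).unique (isHolonomy_scaledForm_toCurve ha z e)

lemma isHolCylS_comp_viaHolonomies {s : ℂ → SmoothConnC} (hs : ∀ z, (s z).1 = scaledForm A₀ z)
    {F : GenConn SL2 → ℂ} (hF : F ∈ HolCyl) : IsHolCylS (F ∘ viaHolonomies s) := by
  obtain ⟨n, e, f, hf, hFf⟩ := hF
  refine ⟨n, fun j => a * ‖(e j).dir‖, fun ζ => f fun j => rotMat (e j).dir (ζ j), ?_, fun z => ?_⟩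
  · refine hf.differentiableOn.comp (differentiableOn_pi.mpr fun j ζ hζ => ?_)
      fun ζ hζ j => det_rotMat (e j).dir_ne_zero (hζ j)
    exact DifferentiableAt.differentiableWithinAt <| DifferentiableAt.fun_comp' (g := rotMat _) ζ
      (hasDerivAt_rotMat (e j).dir_ne_zero (hζ j)).differentiableAt (differentiableAt_apply j ζ)
  · simp only [Function.comp_apply, hFf, viaHolonomies_toCurve ha hs]
    rfl

end Symmetric

/-! ### The heat flow of a symmetric operator -/

section HeatFlow

variable {H : Type*} [NormedAddCommGroup H] [InnerProductSpace ℂ H] {T : H →ₗ.[ℂ] H} {u : ℝ → H}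

/-- `t ↦ ⟪u t, u (b - t)⟫` is constant along the heat flow of a symmetric operator. -/
lemma inner_heatFlow_eq_inner_midpoint (hT : T.IsFormalAdjoint T)
    (hc : ContinuousOn u (Set.Ici 0))
    (hd : ∀ t : ℝ, 0 < t → ∃ ht : u t ∈ T.domain, HasDerivAt u (-(T ⟨u t, ht⟩)) t) {b : ℝ}
    (hb : 0 ≤ b) : inner ℂ (u 0) (u b) = inner ℂ (u (b / 2)) (u (b / 2)) := by
  have hcont : ContinuousOn (fun t => inner ℂ (u t) (u (b - t))) (Set.Icc 0 b) :=
    (hc.mono Set.Icc_subset_Ici_self).inner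
      (hc.comp (f := fun t => b - t) (by fun_prop) fun t ht => sub_nonneg.mpr ht.2)
  have hder : ∀ t ∈ Set.Ioo 0 b \ ∅, HasDerivAt (fun t => inner ℂ (u t) (u (b - t))) 0 t := by
    rintro t ⟨ht, -⟩
    obtain ⟨m, hu⟩ := hd t ht.1
    obtain ⟨m', hu'⟩ := hd (b - t) (sub_pos.mpr ht.2)
    have hsymm : inner ℂ (T ⟨u t, m⟩) (u (b - t)) = inner ℂ (u t) (T ⟨u (b - t), m'⟩) :=
      hT ⟨u t, m⟩ ⟨u (b - t), m'⟩
    refine (hu.inner ℂ (hu'.scomp t ((hasDerivAt_id t).const_sub b))).congr_deriv ?_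
    simp [inner_neg_left, hsymm]
  have hmid : b / 2 ∈ Set.Icc 0 b := ⟨by linarith, by linarith⟩
  have := eqOn_const_of_hasDerivAt_zero hcont Set.countable_empty hder hmid
  rw [sub_half, sub_zero] at this
  exact this.symm

lemma IsExpNeg.eq_zero_of_left (hT : T.IsFormalAdjoint T) {y : H} (h : IsExpNeg T 0 y) :
    y = 0 := by
  obtain ⟨u, hc, h0, rfl, hd⟩ := h
  have h := inner_heatFlow_eq_inner_midpoint hT hc hd zero_le_two
  rw [h0, inner_zero_left, div_self two_ne_zero] at h
  exact inner_self_eq_zero.mp h.symm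

lemma IsExpNeg.eq_zero_of_right (hT : T.IsFormalAdjoint T) {x : H} (h : IsExpNeg T x 0) :
    x = 0 := by
  obtain ⟨u, hc, rfl, h1, hd⟩ := h
  have hpow (n : ℕ) : u ((1 / 2) ^ n) = 0 := by
    induction n with
    | zero => simpa using h1
    | succ n ih =>
      have h := inner_heatFlow_eq_inner_midpoint hT hc hd (b := (1 / 2) ^ n) (by positivity)
      rw [ih, inner_zero_right] at h
      rw [pow_succ, mul_one_div]
      exact inner_self_eq_zero.mp h.symm
  have hlim : Filter.Tendsto (fun n : ℕ => ((1 / 2) ^ n : ℝ)) Filter.atTop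
      (nhdsWithin 0 (Set.Ici 0)) :=
    tendsto_nhdsWithin_iff.mpr
      ⟨tendsto_pow_atTop_nhds_zero_of_lt_one (by norm_num) (by norm_num),
        Filter.Eventually.of_forall fun n => Set.mem_Ici.mpr (by positivity)⟩
  refine tendsto_nhds_unique ((hc 0 Set.self_mem_Ici).tendsto.comp hlim) ?_
  simp only [Function.comp_def, hpow, tendsto_const_nhds]

lemma isFormalAdjoint_self_of_isSelfAdjoint [CompleteSpace H] (hT : IsSelfAdjoint T) :
    T.IsFormalAdjoint T := by
  have h := LinearPMap.adjoint_isFormalAdjoint hT.dense_domain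
  rwa [LinearPMap.isSelfAdjoint_def.mp hT] at h

end HeatFlow

/-! ### Cylindrical functions and the Ashtekar–Lewandowski measure -/

lemma continuous_toFun_apply {S : Set Mat} (γ : Curve) :
    Continuous fun A : GenConn S => A.toFun γ :=
  (continuous_apply γ).comp continuous_induced_dom

lemma continuous_of_mem_cyl {𝕜 : Type} [NontriviallyNormedField 𝕜] [NormedAlgebra 𝕜 ℂ]
    {S : Set Mat} {Φ : GenConn S → ℂ} (hΦ : Φ ∈ cyl 𝕜 S) : Continuous Φ := by
  obtain ⟨n, e, f, hf, h⟩ := hΦ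
  rw [funext h]
  exact hf.continuousOn.comp_continuous (continuous_pi fun i => continuous_toFun_apply _)
    fun A i => A.mem _

lemma continuous_complexify : Continuous GenConn.complexify :=
  continuous_induced_rng.mpr continuous_induced_dom

lemma entry_mem_cyl (𝕜 : Type) [NontriviallyNormedField 𝕜] [NormedAlgebra 𝕜 ℂ] (S : Set Mat)
    (e : StraightEdge) (i j : Fin 2) : (fun A : GenConn S => A.toFun e.toCurve i j) ∈ cyl 𝕜 S := by
  let L : (Fin 1 → Mat) →L[𝕜] ℂ :=
    ⟨{ toFun := fun g => g 0 i j, map_add' := fun _ _ => rfl, map_smul' := fun _ _ => rfl },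
      (continuous_apply 0).matrix_elem i j⟩
  exact ⟨1, fun _ => e, L, L.analyticOn _, fun _ => rfl⟩

section Dense

variable {μ : MeasureTheory.Measure (GenConn SU2)} (hμ : IsAshtekarLewandowski μ)
  {n : ℕ} {γ : Fin n → Curve} (hγ : IsGraph γ) {g : Fin n → Mat} (hg : ∀ i, g i ∈ SU2)

include hμ hγ hg

/-- By left invariance, the distance to a closed set missing `g` would otherwise have mean
zero. -/
lemma mem_closure_range_holonomies :
    g ∈ closure (Set.range fun (A : GenConn SU2) i => A.toFun (γ i)) := by
  have := hμ.prob
  have := hμ.faithful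
  set R := Set.range fun (A : GenConn SU2) i => A.toFun (γ i)
  by_contra hg'
  have hR : R.Nonempty := ⟨_, GenConn.trivial one_mem_SU2, rfl⟩
  have hpos : 0 < Metric.infDist g R := (Metric.infDist_pos_iff_notMem_closure hR).1 hg'
  let b : (Fin n → Mat) → ℝ := fun x => min 1 (Metric.infDist x R)
  have hb : Continuous b := continuous_const.min (Metric.continuous_infDist_pt R)
  have hb0 (x) : 0 ≤ b x := le_min zero_le_one Metric.infDist_nonneg
  have hzero (A : GenConn SU2) : b (fun i => A.toFun (γ i)) = 0 := by
    simp only [b, Metric.infDist_zero_of_mem (show (fun i => A.toFun (γ i)) ∈ R from ⟨A, rfl⟩),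
      min_eq_right zero_le_one]
  have hcont : Continuous fun A : GenConn SU2 => b fun i => g i * A.toFun (γ i) :=
    hb.comp (continuous_pi fun i => continuous_const.matrix_mul (continuous_toFun_apply _))
  have hint : MeasureTheory.Integrable (fun A => b fun i => g i * A.toFun (γ i)) μ :=
    .of_bound (C := 1) hcont.measurable.aestronglyMeasurable <| .of_forall fun A => by
      rw [Real.norm_of_nonneg (hb0 _)]
      exact min_le_left _ _
  have hpos' : 0 < ∫ A : GenConn SU2, b (fun i => g i * A.toFun (γ i)) ∂μ := by
    refine MeasureTheory.integral_pos_of_integrable_nonneg_nonzero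
      (x := GenConn.trivial one_mem_SU2) hcont hint (fun A => hb0 _) ?_
    simpa only [GenConn.trivial, mul_one] using (lt_min one_pos hpos).ne'
  have hinv := hμ.haar n γ hγ g hg (fun x => (b x : ℂ)) (Complex.continuous_ofReal.comp hb)
  simp only [hzero, Complex.ofReal_zero, MeasureTheory.integral_zero, integral_complex_ofReal]
    at hinv
  exact hpos'.ne' (Complex.ofReal_eq_zero.mp hinv)

end Dense

/-! ### Mean values and Bohr coefficients -/

section Mean

open Filter Topology intervalIntegral

variable {E : Type*} [NormedAddCommGroup E] [NormedSpace ℝ E]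

/-- `a` is the mean value of `f` over the line: the integral against the Haar measure of the Bohr
compactification when `f` is almost periodic. -/
def HasMean (f : ℝ → E) (a : E) : Prop :=
  Tendsto (fun T : ℝ => (2 * T)⁻¹ • ∫ c in (-T)..T, f c) atTop (𝓝 a)

lemma hasMean_const [CompleteSpace E] (a : E) : HasMean (fun _ => a) a := by
  refine tendsto_const_nhds.congr' ?_
  filter_upwards [eventually_gt_atTop 0] with T hT
  rw [integral_const, smul_smul, sub_neg_eq_add, ← two_mul, inv_mul_cancel₀ (by positivity),
    one_smul]

lemma HasMean.add {f g : ℝ → E} {a b : E} (hf : Continuous f) (hg : Continuous g)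
    (ha : HasMean f a) (hb : HasMean g b) : HasMean (fun c => f c + g c) (a + b) := by
  refine (Tendsto.add ha hb).congr fun T => ?_
  rw [← smul_add, integral_add (hf.intervalIntegrable _ _) (hg.intervalIntegrable _ _)]

lemma HasMean.sum {ι : Type*} (s : Finset ι) {f : ι → ℝ → E} {a : ι → E}
    (hf : ∀ i ∈ s, Continuous (f i)) (ha : ∀ i ∈ s, HasMean (f i) (a i)) :
    HasMean (fun c => ∑ i ∈ s, f i c) (∑ i ∈ s, a i) := by
  refine (tendsto_finsetSum s ha).congr fun T => ?_
  rw [← Finset.smul_sum, integral_finsetSum fun i hi => (hf i hi).intervalIntegrable _ _]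

lemma HasMean.const_mul {f : ℝ → ℂ} {a : ℂ} (k : ℂ) (ha : HasMean f a) :
    HasMean (fun c => k * f c) (k * a) := by
  refine (Tendsto.const_mul k ha).congr fun T => ?_
  rw [integral_const_mul, mul_smul_comm]

lemma HasMean.re {f : ℝ → ℂ} {a : ℂ} (hf : Continuous f) (ha : HasMean f a) :
    HasMean (fun c => (f c).re) a.re := by
  refine ((Complex.continuous_re.tendsto a).comp ha).congr fun T => ?_
  have := Complex.reCLM.intervalIntegral_comp_comm
    (hf.intervalIntegrable (μ := MeasureTheory.volume) (-T) T)
  simp only [Complex.reCLM_apply] at this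
  simp only [Function.comp_apply, Complex.real_smul, Complex.re_ofReal_mul, smul_eq_mul, this]

lemma HasMean.mono {f g : ℝ → ℝ} {a b : ℝ} (hf : Continuous f) (hg : Continuous g)
    (ha : HasMean f a) (hb : HasMean g b) (h : ∀ c, f c ≤ g c) : a ≤ b := by
  refine le_of_tendsto_of_tendsto ha hb ?_
  filter_upwards [eventually_gt_atTop 0] with T hT
  exact smul_le_smul_of_nonneg_left (integral_mono (by linarith) (hf.intervalIntegrable _ _)
    (hg.intervalIntegrable _ _) h) (by positivity)

lemma hasMean_zero_of_approx {f : ℝ → E} (hf : Continuous f)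
    (h : ∀ ε > 0, ∃ g : ℝ → E, Continuous g ∧ HasMean g 0 ∧ ∀ c, ‖f c - g c‖ ≤ ε) :
    HasMean f 0 := by
  refine Metric.tendsto_nhds.mpr fun ε hε => ?_
  obtain ⟨g, hg, hg0, hfg⟩ := h (ε / 2) (by positivity)
  filter_upwards [Metric.tendsto_nhds.mp hg0 (ε / 2) (by positivity), eventually_gt_atTop 0]
    with T hT hT0
  have hsub : ‖(2 * T)⁻¹ • ∫ c in (-T)..T, (f c - g c)‖ ≤ ε / 2 := by
    have := norm_integral_le_of_norm_le_const (a := -T) (b := T) fun c _ => hfg c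
    rw [sub_neg_eq_add, ← two_mul, abs_of_pos (by positivity)] at this
    rw [norm_smul, norm_inv, Real.norm_of_nonneg (by positivity), inv_mul_le_iff₀ (by positivity)]
    linarith
  rw [integral_sub (hf.intervalIntegrable _ _) (hg.intervalIntegrable _ _), smul_sub] at hsub
  rw [dist_zero_right] at hT ⊢
  linarith [norm_le_norm_add_norm_sub' ((2 * T)⁻¹ • ∫ c in (-T)..T, f c)
    ((2 * T)⁻¹ • ∫ c in (-T)..T, g c)]

lemma HasMean.translate {f : ℝ → ℝ} (hf : Continuous f) (hf0 : ∀ c, 0 ≤ f c) (h : HasMean f 0)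
    (d : ℝ) : HasMean (fun c => f (c + d)) 0 := by
  have hshift : Tendsto (fun T : ℝ => T + |d|) atTop atTop :=
    tendsto_atTop_add_const_right _ _ tendsto_id
  have hratio : Tendsto (fun T : ℝ => 1 + |d| * T⁻¹) atTop (𝓝 (1 + |d| * 0)) :=
    (tendsto_inv_atTop_zero.const_mul _).const_add _
  have hbound := hratio.mul (h.comp hshift)
  rw [mul_zero] at hbound
  refine squeeze_zero' ?_ ?_ hbound
  · filter_upwards [eventually_gt_atTop 0] with T hT
    exact smul_nonneg (by positivity) (integral_nonneg (by linarith) fun c _ => hf0 _)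
  · filter_upwards [eventually_gt_atTop 0] with T hT
    rw [integral_comp_add_right, smul_eq_mul]
    have hle : ∫ c in (-T + d)..(T + d), f c ≤ ∫ c in (-(T + |d|))..(T + |d|), f c :=
      integral_mono_interval (by linarith [neg_abs_le d]) (by linarith)
        (by linarith [le_abs_self d]) (.of_forall hf0) (hf.intervalIntegrable _ _)
    calc _ ≤ (2 * T)⁻¹ * ∫ c in (-(T + |d|))..(T + |d|), f c :=
          mul_le_mul_of_nonneg_left hle (by positivity)
      _ = _ := by
          simp only [Function.comp_apply, smul_eq_mul]
          field_simp

/-- The closure of the orbit is covered by finitely many translates of a set on which `k` is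
bounded below, so a sum of finitely many translates of `k ∘ ρ` is bounded below. -/
lemma HasMean.eq_zero_of_nonneg {K : Type*} [AddGroup K] [TopologicalSpace K]
    [IsTopologicalAddGroup K] [CompactSpace K] {ρ : ℝ →+ K} (hρ : Continuous ρ) {k : K → ℝ}
    (hk : Continuous k) (hk0 : ∀ x, 0 ≤ k x) (h : HasMean (fun c => k (ρ c)) 0) (d : ℝ) :
    k (ρ d) = 0 := by
  by_contra hne
  obtain ⟨δ, hδ0, hδ⟩ := exists_between ((hk0 _).lt_of_ne' hne)
  have hopen (t : ℝ) : IsOpen {x | δ < k (x + ρ t)} :=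
    isOpen_lt continuous_const (hk.comp (continuous_id.add continuous_const))
  have hcover : closure (Set.range ρ) ⊆ ⋃ t, {x | δ < k (x + ρ t)} := by
    intro x hx
    have hV : IsOpen {y | δ < k (x + (-y + ρ d))} :=
      isOpen_lt continuous_const (hk.comp (by fun_prop))
    obtain ⟨_, hy, s, rfl⟩ := mem_closure_iff.mp hx _ hV (by simpa using hδ)
    refine Set.mem_iUnion.mpr ⟨-s + d, ?_⟩
    rwa [Set.mem_ofPred_eq, map_add, map_neg]
  obtain ⟨F, hF⟩ := isClosed_closure.isCompact.elim_finite_subcover _ hopen hcover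
  have hcont : Continuous fun c => k (ρ c) := hk.comp hρ
  have hsum := HasMean.sum F (fun t _ => hcont.comp (continuous_add_const t))
    fun t _ => h.translate hcont (fun c => hk0 _) t
  rw [Finset.sum_const_zero] at hsum
  refine hδ0.not_ge (HasMean.mono continuous_const ?_ (hasMean_const δ) hsum fun c => ?_)
  · exact continuous_finsetSum F fun t _ => hcont.comp (continuous_add_const t)
  · obtain ⟨t, ht, hc⟩ := Set.mem_iUnion₂.mp (hF (subset_closure ⟨c, rfl⟩))
    rw [Set.mem_ofPred_eq, ← map_add] at hc
    exact hc.le.trans (Finset.single_le_sum (f := fun t => k (ρ (c + t))) (fun _ _ => hk0 _) ht)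

lemma hasMean_expFn {ν : ℝ} (hν : ν ≠ 0) : HasMean (fun c => expFn ν c) 0 := by
  have hν' : Complex.I * ν / 2 ≠ 0 := by
    simp [Complex.I_ne_zero, hν]
  have hint (T : ℝ) : ∫ c in (-T)..T, expFn ν c =
      (Complex.I * ν / 2)⁻¹ * (expFn ν T - expFn ν (-T : ℝ)) := by
    rw [integral_eq_sub_of_hasDerivAt (f := fun c : ℝ => (Complex.I * ν / 2)⁻¹ * expFn ν c),
      mul_sub]
    · intro c _
      have := ((hasDerivAt_expFn ν c).comp_ofReal).const_mul (Complex.I * ν / 2)⁻¹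
      exact this.congr_deriv (by rw [inv_mul_cancel_left₀ hν'])
    · exact (continuous_expFn_ofReal ν).intervalIntegrable _ _
  have hinv : Tendsto (fun T : ℝ => (2 * T)⁻¹) atTop (𝓝 0) :=
    (tendsto_id.const_mul_atTop two_pos).inv_tendsto_atTop
  refine hinv.zero_smul_isBoundedUnder_le (isBoundedUnder_of ⟨‖(Complex.I * ν / 2)⁻¹‖ * 2, ?_⟩)
  intro T
  rw [Function.comp_apply, hint, norm_mul]
  refine mul_le_mul_of_nonneg_left ((norm_sub_le _ _).trans ?_) (norm_nonneg _)
  rw [norm_expFn_ofReal, norm_expFn_ofReal, one_add_one_eq_two]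

variable {φ : ℝ → ℂ}

lemma isBohrCoeff_iff (hφ : Continuous φ) {ν : ℝ} {a : ℂ} :
    IsBohrCoeff φ ν a ↔ HasMean (fun c => expFn (-ν) c * φ c) a := by
  simp only [IsBohrCoeff, hφ.intervalIntegrable, implies_true, true_and, HasMean, expFn,
    Complex.real_smul, Complex.ofReal_inv, Complex.ofReal_neg, mul_neg, neg_mul, neg_div]

lemma isBohrCoeff_expFn (ν κ : ℝ) :
    IsBohrCoeff (fun c => expFn ν c) κ (if ν = κ then 1 else 0) := by
  rw [isBohrCoeff_iff (continuous_expFn_ofReal ν)]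
  have h (c : ℝ) : expFn (-κ) c * expFn ν c = expFn (ν - κ) c := by
    rw [← Pi.mul_apply, expFn_mul, neg_add_eq_sub]
  simp only [h]
  split_ifs with hνκ
  · simpa only [hνκ, sub_self, expFn_zero, Pi.one_apply] using hasMean_const (1 : ℂ)
  · exact hasMean_expFn (sub_ne_zero.mpr hνκ)

end Mean

section Torus

variable {ι : Type*} (m : ι → ℝ)

/-- The one-parameter subgroup `c ↦ (e^{i m_j c / 2})_j` of the torus. -/
def torusLine : ℝ →+ UnitAddTorus ι :=
  AddMonoidHom.mk' (fun c j => ((m j * c / (4 * Real.pi) : ℝ) : UnitAddCircle)) fun c d => by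
    funext j
    simp only [Pi.add_apply, ← AddCircle.coe_add, mul_add, add_div]

lemma continuous_torusLine : Continuous (torusLine m) :=
  continuous_pi fun _ => (AddCircle.continuous_mk' 1).comp (by fun_prop)

lemma fourier_torusLine (k : ℤ) (c : ℝ) (j : ι) :
    fourier k (torusLine m c j) = expFn (k * m j) c := by
  change fourier k ((m j * c / (4 * Real.pi) : ℝ) : UnitAddCircle) = _
  rw [fourier_coe_apply, expFn]
  congr 1
  have : (Real.pi : ℂ) ≠ 0 := Complex.ofReal_ne_zero.mpr Real.pi_ne_zero
  push_cast
  field_simp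
  ring

lemma mFourier_torusLine [Fintype ι] (k : ι → ℤ) (c : ℝ) :
    UnitAddTorus.mFourier k (torusLine m c) = expFn (∑ j, k j * m j) c := by
  simp only [UnitAddTorus.mFourier, ContinuousMap.coe_mk, fourier_torusLine, expFn,
    ← Complex.exp_sum]
  push_cast
  rw [Finset.mul_sum, Finset.sum_mul, Finset.sum_div]

variable {φ : ℝ → ℂ}

lemma HasMean.torusLine_mul [Finite ι] (hφ : Continuous φ) {B : ℝ} (hB : ∀ c, ‖φ c‖ ≤ B)
    (h : ∀ ν, HasMean (fun c => expFn ν c * φ c) 0) (p : C(UnitAddTorus ι, ℂ)) :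
    HasMean (fun c => p (torusLine m c) * φ c) 0 := by
  have := Fintype.ofFinite ι
  have hcont (q : C(UnitAddTorus ι, ℂ)) : Continuous fun c => q (torusLine m c) * φ c :=
    ((map_continuous q).comp (continuous_torusLine m)).mul hφ
  have htrig : ∀ q ∈ Submodule.span ℂ (Set.range UnitAddTorus.mFourier),
      HasMean (fun c => q (torusLine m c) * φ c) 0 := by
    intro q hq
    induction hq using Submodule.span_induction with
    | mem q hq =>
      obtain ⟨k, rfl⟩ := hq
      simpa only [mFourier_torusLine] using h _
    | zero => simpa only [ContinuousMap.zero_apply, zero_mul] using hasMean_const 0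
    | add q r _ _ hq hr =>
      simpa only [ContinuousMap.add_apply, add_mul, add_zero] using hq.add (hcont q) (hcont r) hr
    | smul a q _ hq =>
      simpa only [ContinuousMap.smul_apply, smul_eq_mul, mul_assoc, mul_zero] using hq.const_mul a
  refine hasMean_zero_of_approx (hcont p) fun ε hε => ?_
  have hB0 : 0 ≤ B := (norm_nonneg _).trans (hB 0)
  have hp : p ∈ (Submodule.span ℂ (Set.range UnitAddTorus.mFourier)).topologicalClosure := by
    rw [UnitAddTorus.span_mFourier_closure_eq_top]
    trivial
  obtain ⟨q, hq, hpq⟩ := Metric.mem_closure_iff.mp hp (ε / (B + 1)) (by positivity)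
  refine ⟨_, hcont q, htrig q hq, fun c => ?_⟩
  rw [← sub_mul, norm_mul]
  calc ‖p (torusLine m c) - q (torusLine m c)‖ * ‖φ c‖ ≤ ε / (B + 1) * (B + 1) :=
        mul_le_mul (((p - q).norm_coe_le_norm _).trans (dist_eq_norm p q ▸ hpq.le))
          ((hB c).trans (by linarith)) (norm_nonneg _) (by positivity)
    _ = ε := div_mul_cancel₀ _ (by positivity)

/-- The mean value of `‖φ‖²` vanishes, since `conj φ` is a uniform limit of trigonometric
polynomials. -/
lemma eq_zero_of_isBohrCoeff_zero [Finite ι] (g : C(UnitAddTorus ι, ℂ))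
    (h : ∀ ν, IsBohrCoeff (fun c => g (torusLine m c)) ν 0) (c : ℝ) : g (torusLine m c) = 0 := by
  have hg : Continuous fun c => g (torusLine m c) :=
    (map_continuous g).comp (continuous_torusLine m)
  have hmean : HasMean (fun c => star g (torusLine m c) * g (torusLine m c)) 0 := by
    refine HasMean.torusLine_mul m hg (fun c => g.norm_coe_le_norm _) (fun ν => ?_) (star g)
    simpa only [neg_neg] using (isBohrCoeff_iff hg).mp (h (-ν))
  have hsq : HasMean (fun c => ‖g (torusLine m c)‖ ^ 2) 0 := by
    have hstar : Continuous fun c => star g (torusLine m c) :=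
      (map_continuous (star g)).comp (continuous_torusLine m)
    convert hmean.re (hstar.mul hg) using 2 with c
    · rw [Pi.mul_apply, ContinuousMap.star_apply, Complex.star_def, Complex.conj_mul',
        ← Complex.ofReal_pow, Complex.ofReal_re]
    · exact Complex.zero_re.symm
  have := hsq.eq_zero_of_nonneg (k := fun x => ‖g x‖ ^ 2) (continuous_torusLine m) (by fun_prop)
    (fun x => by positivity) c
  simpa using this

end Torus

section CylS

variable {A₀ : SmoothConn} {a : ℝ} (ha : ∀ x v, A₀.1 x v = a • v) {φ : ℝ → ℂ}
  (hφ : φ ∈ CylS A₀)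

include ha hφ

lemma exists_eq_torusLine_of_mem_cylS : ∃ (n : ℕ) (m : Fin n → ℝ) (g : C(UnitAddTorus (Fin n), ℂ)),
    φ = fun c => g (torusLine m c) := by
  obtain ⟨Φ, ⟨n, e, f, hf, hΦ⟩, rfl⟩ := hφ
  have hcont (v : Space) : Continuous fun x : UnitAddCircle => rotMat v (fourier 1 x) :=
    ((map_continuous (fourier 1)).smul continuous_const).add
      (((map_continuous (fourier 1)).inv₀ fun x => Circle.coe_ne_zero _).smul continuous_const)
  refine ⟨n, fun j => a * ‖(e j).dir‖,
    ⟨fun x => f fun j => rotMat (e j).dir (fourier 1 (x j)), ?_⟩, funext fun c => ?_⟩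
  · exact hf.continuousOn.comp_continuous
      (continuous_pi fun j => (hcont _).comp (continuous_apply j))
      fun x j => rotMat_mem_SU2 (e j).dir_ne_zero (Circle.norm_coe _)
  · simp only [LinearMap.funLeft_apply, hΦ, symmConn_toCurve ha, ContinuousMap.coe_mk,
      fourier_torusLine, Int.cast_one, one_mul]

lemma eq_zero_of_mem_cylS (h : ∀ ν, IsBohrCoeff φ ν 0) : φ = 0 := by
  obtain ⟨n, m, g, rfl⟩ := exists_eq_torusLine_of_mem_cylS ha hφ
  exact funext (eq_zero_of_isBohrCoeff_zero m g h)

end CylS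

/-! ### `SU(n)` is a set of uniqueness for holomorphic functions on `SL(n, ℂ)` -/

section CartanPath

open Matrix
open scoped ComplexOrder

variable {n : Type*} [Fintype n] [DecidableEq n]

lemma exists_conjTranspose_mul_self_eq_diagonal_exp {g : Matrix n n ℂ} (hg : g.det = 1) :
    ∃ W ∈ unitaryGroup n ℂ, ∃ x : n → ℝ, ∑ j, x j = 0 ∧
      Wᴴ * (gᴴ * g) * W = diagonal fun j => Complex.exp (2 * x j) := by
  have hpos : (gᴴ * g).PosDef := .conjTranspose_mul_self g
    (mulVec_injective_of_isUnit ((isUnit_iff_isUnit_det g).mpr (hg ▸ isUnit_one)))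
  have hH := hpos.isHermitian
  have hprod : ∏ j, hH.eigenvalues j = 1 := by
    have := hH.det_eq_prod_eigenvalues
    rw [det_mul, det_conjTranspose, hg, star_one, one_mul] at this
    exact Complex.ofReal_injective (by simpa using this.symm)
  refine ⟨hH.eigenvectorUnitary, hH.eigenvectorUnitary.2, fun j => Real.log (hH.eigenvalues j) / 2,
    ?_, ?_⟩
  · rw [← Finset.sum_div, ← Real.log_prod fun j _ => (hpos.eigenvalues_pos j).ne', hprod,
      Real.log_one, zero_div]
  · have hspec := hH.conjStarAlgAut_star_eigenvectorUnitary
    rw [Unitary.conjStarAlgAut_star_apply] at hspec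
    refine hspec.trans (congrArg diagonal (funext fun j => ?_))
    rw [Complex.ofReal_div, Complex.ofReal_ofNat, mul_div_cancel₀ _ two_ne_zero,
      ← Complex.ofReal_exp, Real.exp_log (hpos.eigenvalues_pos j)]
    rfl

/-- For `Wᴴ (gᴴ g) W = diag(e^{2x})` the path is `ζ ↦ g W diag(e^{-(1 + iζ)x}) Wᴴ`. -/
lemma exists_differentiable_path_specialUnitaryGroup {g : Matrix n n ℂ} (hg : g.det = 1) :
    ∃ p : ℂ → Matrix n n ℂ, Differentiable ℂ p ∧ (∀ ζ, (p ζ).det = 1) ∧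
      (∀ t : ℝ, p t ∈ specialUnitaryGroup n ℂ) ∧ p Complex.I = g := by
  obtain ⟨W, hW, x, hx, hdiag⟩ := exists_conjTranspose_mul_self_eq_diagonal_exp hg
  have hW' : W * Wᴴ = 1 := mem_unitaryGroup_iff.mp hW
  let d (ζ : ℂ) (j : n) : ℂ := Complex.exp (-(1 + Complex.I * ζ) * x j)
  let p (ζ : ℂ) : Matrix n n ℂ := g * W * diagonal (d ζ) * Wᴴ
  have hdet (ζ : ℂ) : (p ζ).det = 1 := by
    have hd : ∏ j, d ζ j = 1 := by
      rw [← Complex.exp_sum, ← Finset.mul_sum, ← Complex.ofReal_sum, hx, Complex.ofReal_zero,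
        mul_zero, Complex.exp_zero]
    rw [det_mul, det_mul, det_mul, det_diagonal, hd, hg, one_mul, mul_one, ← det_mul, hW', det_one]
  refine ⟨p, ?_, hdet, fun t => mem_specialUnitaryGroup_iff.mpr ⟨?_, hdet t⟩, ?_⟩
  · refine differentiable_pi.mpr fun i => differentiable_pi.mpr fun j => ?_
    simp only [p, d, mul_apply (N := Wᴴ), mul_diagonal]
    fun_prop
  · have hunit : (diagonal (d t))ᴴ * diagonal (fun j => Complex.exp (2 * x j)) * diagonal (d t)
        = 1 := by
      rw [diagonal_conjTranspose, diagonal_mul_diagonal, diagonal_mul_diagonal, ← diagonal_one]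
      congr 1
      funext j
      rw [Pi.star_apply, Complex.star_def, ← Complex.exp_conj, ← Complex.exp_add,
        ← Complex.exp_add]
      convert Complex.exp_zero using 2
      simp only [map_mul, map_neg, map_add, map_one, Complex.conj_I, Complex.conj_ofReal]
      ring
    rw [mem_unitaryGroup_iff', star_eq_conjTranspose]
    calc (p t)ᴴ * p t = W * ((diagonal (d t))ᴴ * (Wᴴ * (gᴴ * g) * W) * diagonal (d t)) * Wᴴ := by
          simp only [p, conjTranspose_mul, conjTranspose_conjTranspose, Matrix.mul_assoc]
      _ = 1 := by rw [hdiag, hunit, Matrix.mul_one, hW']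
  · have hd : d Complex.I = 1 := by
      funext j
      simp only [d, Complex.I_mul_I, add_neg_cancel, neg_zero, zero_mul, Complex.exp_zero,
        Pi.one_apply]
    simp only [p, hd]
    rw [diagonal_one', Matrix.mul_one, Matrix.mul_assoc, hW', Matrix.mul_one]

/-- Complexify the paths of `exists_differentiable_path_specialUnitaryGroup` simultaneously in all
factors. -/
lemma eq_zero_of_eqOn_specialUnitaryGroup {ι : Type*} [Finite ι] {h : (ι → Matrix n n ℂ) → ℂ}
    (hd : DifferentiableOn ℂ h {g | ∀ i, (g i).det = 1})
    (h0 : ∀ g, (∀ i, g i ∈ specialUnitaryGroup n ℂ) → h g = 0) {g : ι → Matrix n n ℂ}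
    (hg : ∀ i, (g i).det = 1) : h g = 0 := by
  have := Fintype.ofFinite ι
  choose p hp hdet hSU hpI using fun i => exists_differentiable_path_specialUnitaryGroup (hg i)
  have hpath : Differentiable ℂ fun ζ i => p i ζ := differentiable_pi.mpr hp
  have hcomp : Differentiable ℂ fun ζ => h fun i => p i ζ :=
    differentiableOn_univ.mp (hd.comp hpath.differentiableOn fun ζ _ i => hdet i ζ)
  have := eq_of_differentiable_of_eqOn_real hcomp (differentiable_const 0) fun t =>
    h0 _ fun i => hSU i t
  simpa only [hpI] using congrFun this Complex.I

end CartanPath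

/-! ### Broken edges and words -/

lemma analyticOn_Icc_of_eqOn_affine {E : Type*} [NormedAddCommGroup E] [NormedSpace ℝ E]
    {f : ℝ → E} {a b k l : ℝ} {x v : E} (hab : a < b) (hk : k ≠ 0) (hv : v ≠ 0)
    (hf : Set.EqOn f (fun t => x + (k * t + l) • v) (Set.Icc a b)) :
    AnalyticOn ℝ f (Set.Icc a b) ∧ ∀ t ∈ Set.Icc a b, derivWithin f (Set.Icc a b) t ≠ 0 := by
  have hderiv : ∀ t, HasDerivAt (fun t : ℝ => x + (k * t + l) • v) (k • v) t := fun t => by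
    simpa using ((((hasDerivAt_id t).const_mul k).add_const l).smul_const v).const_add x
  refine ⟨AnalyticOn.congr ?_ hf, fun t ht => ?_⟩
  · exact analyticOn_const.add
      (((analyticOn_const.mul analyticOn_id).add analyticOn_const).smul analyticOn_const)
  · rw [derivWithin_congr hf (hf ht),
      (hderiv t).hasDerivWithinAt.derivWithin (uniqueDiffOn_Icc hab t ht)]
    exact smul_ne_zero hk hv

/-- The piecewise linear time change of `[0,1]` that takes the value `τ` at time `1/2`. -/
def breakTime (τ t : ℝ) : ℝ := if t ≤ 1 / 2 then 2 * τ * t else τ + (2 * t - 1) * (1 - τ)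

lemma breakTime_of_le {τ t : ℝ} (ht : t ≤ 1 / 2) : breakTime τ t = 2 * τ * t := if_pos ht

lemma breakTime_of_ge {τ t : ℝ} (ht : 1 / 2 ≤ t) : breakTime τ t = τ + (2 * t - 1) * (1 - τ) := by
  rcases ht.eq_or_lt with rfl | h
  · rw [breakTime_of_le le_rfl]
    ring
  · exact if_neg h.not_ge

lemma continuous_breakTime (τ : ℝ) : Continuous (breakTime τ) :=
  Continuous.if_le (by fun_prop) (by fun_prop) continuous_id continuous_const fun t ht => by
    rw [ht]
    ring

lemma strictMono_breakTime {τ : ℝ} (hτ : τ ∈ Set.Ioo (0 : ℝ) 1) : StrictMono (breakTime τ) := by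
  have hτ0 := hτ.1
  have hτ1 := hτ.2
  intro s t hst
  simp only [breakTime]
  split_ifs <;> nlinarith

lemma differentiableAt_breakTime (τ : ℝ) {t : ℝ} (ht : t ≠ 1 / 2) :
    DifferentiableAt ℝ (breakTime τ) t := by
  rcases ht.lt_or_gt with h | h
  · have hd : DifferentiableAt ℝ (fun t : ℝ => 2 * τ * t) t := by fun_prop
    exact hd.congr_of_eventuallyEq
      ((eventually_lt_nhds h).mono fun y hy => breakTime_of_le hy.le)
  · have hd : DifferentiableAt ℝ (fun t : ℝ => τ + (2 * t - 1) * (1 - τ)) t := by fun_prop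
    exact hd.congr_of_eventuallyEq
      ((eventually_gt_nhds h).mono fun y hy => breakTime_of_ge hy.le)

/-- The straight edge `e`, run through so that the point dividing it in the ratio `τ : 1 - τ` is
reached at time `1/2`. -/
def StraightEdge.breakAt (e : StraightEdge) {τ : ℝ} (hτ : τ ∈ Set.Ioo (0 : ℝ) 1) : Curve where
  toFun t := e.src + breakTime τ t • e.dir
  piecewiseAnalytic := by
    refine ⟨2, ![0, 1 / 2, 1], ?_, rfl, rfl, fun i => ?_⟩
    · refine Fin.strictMono_iff_lt_succ.mpr fun i => ?_
      fin_cases i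
      · exact one_half_pos
      · exact one_half_lt_one
    · fin_cases i
      · refine analyticOn_Icc_of_eqOn_affine (k := 2 * τ) (l := 0) (x := e.src) one_half_pos
          (mul_ne_zero two_ne_zero hτ.1.ne') e.dir_ne_zero fun t ht => ?_
        simp only [breakTime_of_le ht.2, add_zero]
      · refine analyticOn_Icc_of_eqOn_affine (k := 2 * (1 - τ)) (l := 2 * τ - 1) (x := e.src)
          one_half_lt_one (mul_ne_zero two_ne_zero (sub_pos.mpr hτ.2).ne') e.dir_ne_zero
          fun t ht => ?_
        simp only [breakTime_of_ge ht.1]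
        congr 2
        ring

lemma GenConn.toFun_breakAt {S : Set Mat} (A : GenConn S) (e : StraightEdge) {τ : ℝ}
    (hτ : τ ∈ Set.Ioo (0 : ℝ) 1) : A.toFun (e.breakAt hτ) = A.toFun e.toCurve :=
  A.reparam _ _ (breakTime τ) (continuous_breakTime τ).continuousOn
    ((strictMono_breakTime hτ).strictMonoOn _) (by norm_num [breakTime]) (by norm_num [breakTime])
    ⟨{1 / 2}, Set.finite_singleton _, fun _ ht => differentiableAt_breakTime τ ht.2⟩
    fun _ _ => rfl

lemma GenConn.toFun_of_sbtw {S : Set Mat} (A : GenConn S) {p x q : Space} (h : Sbtw ℝ p x q) :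
    A.toFun (StraightEdge.mk p q h.left_ne_right).toCurve =
      A.toFun (StraightEdge.mk x q h.ne_right).toCurve *
        A.toFun (StraightEdge.mk p x h.left_ne).toCurve := by
  obtain ⟨τ, hτ, hx⟩ := (sbtw_iff_mem_image_Ioo_and_ne.mp h).1
  rw [AffineMap.lineMap_apply_module'] at hx
  rw [← A.toFun_breakAt _ hτ]
  refine A.comp _ _ _ (fun t ht => ?_) fun t ht => ?_
  · simp only [StraightEdge.breakAt, StraightEdge.toCurve, StraightEdge.dir,
      breakTime_of_le ht.2, ← hx]
    module
  · simp only [StraightEdge.breakAt, StraightEdge.toCurve, StraightEdge.dir,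
      breakTime_of_ge ht.1, ← hx]
    module

lemma GenConn.toFun_reverse (A : GenConn SL2) {p q : Space} (hpq : p ≠ q) :
    A.toFun (StraightEdge.mk q p hpq.symm).toCurve =
      (A.toFun (StraightEdge.mk p q hpq).toCurve).adjugate := by
  have hdet : (A.toFun (StraightEdge.mk p q hpq).toCurve).det = 1 := A.mem _
  have hinv := A.inv (StraightEdge.mk p q hpq).toCurve (StraightEdge.mk q p hpq.symm).toCurve
    fun t _ => by simp only [StraightEdge.toCurve]; module
  rw [← Matrix.inv_eq_left_inv hinv, Matrix.inv_def, hdet, Ring.inverse_one, one_smul]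

/-- The holonomies along `e` are a holomorphic function of the holonomies along the `d j`: in the
application, a word in these holonomies and their inverses. -/
def IsWord {m : ℕ} (d : Fin m → StraightEdge) (e : StraightEdge) : Prop :=
  ∃ w : (Fin m → Mat) → Mat, Differentiable ℂ w ∧ (∀ g, (∀ i, g i ∈ SL2) → w g ∈ SL2) ∧
    ∀ A : GenConn SL2, A.toFun e.toCurve = w fun j => A.toFun (d j).toCurve

section IsWord

variable {m : ℕ} {d : Fin m → StraightEdge}

lemma isWord_self (d : Fin m → StraightEdge) (j : Fin m) : IsWord d (d j) :=
  ⟨fun g => g j, differentiable_pi.mp differentiable_id j, fun _ hg => hg j, fun _ => rfl⟩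

lemma IsWord.reverse {p q : Space} {hpq : p ≠ q} (h : IsWord d ⟨p, q, hpq⟩) :
    IsWord d ⟨q, p, hpq.symm⟩ := by
  obtain ⟨w, hw, hwSL, hwA⟩ := h
  have hentry : ∀ i j, Differentiable ℂ fun g => w g i j := fun i j =>
    differentiable_pi.mp (differentiable_pi.mp hw i) j
  refine ⟨fun g => (w g).adjugate, ?_, fun g hg => ?_, fun A => ?_⟩
  · refine differentiable_pi.mpr fun i => differentiable_pi.mpr fun j => ?_
    simp only [Matrix.adjugate_fin_two]
    fin_cases i <;> fin_cases j
    exacts [hentry 1 1, (hentry 0 1).neg, (hentry 1 0).neg, hentry 0 0]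
  · have hdet : (w g).det = 1 := hwSL g hg
    change (w g).adjugate.det = 1
    rw [Matrix.det_adjugate, hdet, one_pow]
  · rw [A.toFun_reverse hpq, hwA]

lemma IsWord.of_sbtw {p x q : Space} (h : Sbtw ℝ p x q) (h₁ : IsWord d ⟨p, x, h.left_ne⟩)
    (h₂ : IsWord d ⟨x, q, h.ne_right⟩) : IsWord d ⟨p, q, h.left_ne_right⟩ := by
  obtain ⟨w₁, hw₁, hSL₁, hA₁⟩ := h₁
  obtain ⟨w₂, hw₂, hSL₂, hA₂⟩ := h₂
  refine ⟨fun g => w₂ g * w₁ g, ?_, fun g hg => ?_, fun A => ?_⟩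
  · refine differentiable_pi.mpr fun i => differentiable_pi.mpr fun j => ?_
    simp only [Matrix.mul_apply, Fin.sum_univ_two]
    have hentry : ∀ w : (Fin m → Mat) → Mat, Differentiable ℂ w →
        ∀ i j, Differentiable ℂ fun g => w g i j := fun w hw i j =>
      differentiable_pi.mp (differentiable_pi.mp hw i) j
    exact ((hentry w₂ hw₂ i 0).mul (hentry w₁ hw₁ 0 j)).add
      ((hentry w₂ hw₂ i 1).mul (hentry w₁ hw₁ 1 j))
  · have hdet₁ : (w₁ g).det = 1 := hSL₁ g hg
    have hdet₂ : (w₂ g).det = 1 := hSL₂ g hg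
    change (w₂ g * w₁ g).det = 1
    rw [Matrix.det_mul, hdet₁, hdet₂, one_mul]
  · rw [A.toFun_of_sbtw h, hA₁, hA₂]

end IsWord

/-! ### Subdividing straight edges into a graph -/

/-- The points of a straight edge. -/
def StraightEdge.support (e : StraightEdge) : Set Space := segment ℝ e.src e.tgt

lemma StraightEdge.support_subset_line (e : StraightEdge) :
    e.support ⊆ line[ℝ, e.src, e.tgt] := fun _ hx => (mem_segment_iff_wbtw.mp hx).mem_affineSpan

lemma StraightEdge.mem_support_of_sbtw {e : StraightEdge} {p x q : Space} (hp : p ∈ e.support)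
    (hq : q ∈ e.support) (h : Sbtw ℝ p x q) : x ∈ e.support :=
  (convex_segment _ _).segment_subset hp hq (mem_segment_iff_wbtw.mpr h.wbtw)

section Subdivision

variable {n : ℕ} {e : Fin n → StraightEdge}

/-- The vertices of the subdivision of a family of straight edges: their end points and their
isolated intersections. -/
def vertices (e : Fin n → StraightEdge) : Set Space :=
  Set.range (fun i => (e i).src) ∪ Set.range (fun i => (e i).tgt) ∪
    ⋃ i, ⋃ j, {x | x ∈ (e i).support ∩ (e j).support ∧
      ((e i).support ∩ (e j).support).Subsingleton}

lemma src_mem_vertices (e : Fin n → StraightEdge) (i : Fin n) : (e i).src ∈ vertices e :=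
  Or.inl (Or.inl ⟨i, rfl⟩)

lemma tgt_mem_vertices (e : Fin n → StraightEdge) (i : Fin n) : (e i).tgt ∈ vertices e :=
  Or.inl (Or.inr ⟨i, rfl⟩)

lemma finite_vertices (e : Fin n → StraightEdge) : (vertices e).Finite := by
  refine ((Set.finite_range _).union (Set.finite_range _)).union
    (Set.finite_iUnion fun i => Set.finite_iUnion fun j => Set.Subsingleton.finite ?_)
  exact fun x hx y hy => hx.2 hx.1 hy.1

/-- `p` and `q` are neighbouring vertices on one of the given edges. -/
structure IsLink (e : Fin n → StraightEdge) (p q : Space) : Prop where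
  ne : p ≠ q
  left_mem : p ∈ vertices e
  right_mem : q ∈ vertices e
  exists_support : ∃ i, p ∈ (e i).support ∧ q ∈ (e i).support
  not_sbtw : ∀ x ∈ vertices e, ¬Sbtw ℝ p x q

lemma sbtw_iff_mem_Ioo {a b t : ℝ} (hab : a < b) : Sbtw ℝ a t b ↔ t ∈ Set.Ioo a b := by
  rw [Sbtw, wbtw_iff_of_le hab.le, Set.mem_Ioo]
  grind

lemma sym2_eq_of_sbtw_real {a b s : ℝ} (hs : Sbtw ℝ 0 s 1) (hs' : Sbtw ℝ a s b)
    (ha : ¬Sbtw ℝ 0 a 1) (hb : ¬Sbtw ℝ 0 b 1) (h0 : ¬Sbtw ℝ a 0 b) (h1 : ¬Sbtw ℝ a 1 b) :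
    s(a, b) = s(0, 1) := by
  wlog hab : a < b generalizing a b
  · rw [Sym2.eq_swap]
    exact this hs'.symm hb ha (fun h => h0 h.symm) (fun h => h1 h.symm)
      (lt_of_le_of_ne (not_lt.mp hab) hs'.left_ne_right.symm)
  · rw [sbtw_iff_mem_Ioo one_pos] at hs ha hb
    rw [sbtw_iff_mem_Ioo hab] at hs' h0 h1
    have ha0 : a = 0 := by grind
    have hb1 : b = 1 := by grind
    rw [ha0, hb1]

lemma sym2_eq_of_sbtw {E : Type*} [AddCommGroup E] [Module ℝ E] {p q p' q' x : E}
    (hp' : p' ∈ line[ℝ, p, q]) (hq' : q' ∈ line[ℝ, p, q]) (hx : Sbtw ℝ p x q)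
    (hx' : Sbtw ℝ p' x q') (h₁ : ¬Sbtw ℝ p p' q) (h₂ : ¬Sbtw ℝ p q' q) (h₃ : ¬Sbtw ℝ p' p q')
    (h₄ : ¬Sbtw ℝ p' q q') : s(p', q') = s(p, q) := by
  have hinj := AffineMap.lineMap_injective ℝ hx.left_ne_right
  obtain ⟨a, rfl⟩ := mem_affineSpan_pair_iff_exists_lineMap_eq.mp hp'
  obtain ⟨b, rfl⟩ := mem_affineSpan_pair_iff_exists_lineMap_eq.mp hq'
  obtain ⟨s, rfl⟩ := mem_affineSpan_pair_iff_exists_lineMap_eq.mp hx.wbtw.mem_affineSpan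
  have hmap : ∀ u v w : ℝ, Sbtw ℝ (AffineMap.lineMap p q u) (AffineMap.lineMap p q v)
      (AffineMap.lineMap p q w) ↔ Sbtw ℝ u v w := fun u v w => hinj.sbtw_map_iff
  have hp := AffineMap.lineMap_apply_zero (k := ℝ) p q
  have hq := AffineMap.lineMap_apply_one (k := ℝ) p q
  have h := sym2_eq_of_sbtw_real ((hmap 0 s 1).mp (by rwa [hp, hq])) ((hmap a s b).mp hx')
    (by rwa [← hmap, hp, hq]) (by rwa [← hmap, hp, hq]) (by rwa [← hmap, hp])
    (by rwa [← hmap, hq])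
  simpa only [Sym2.map_mk, hp, hq] using congrArg (Sym2.map (AffineMap.lineMap p q)) h

/-- On a common line two links that overlap coincide; otherwise their common points are isolated
intersections of two of the given edges, hence vertices. -/
lemma IsLink.notMem_of_sbtw {p q p' q' x : Space} (h : IsLink e p q) (h' : IsLink e p' q')
    (hne : s(p', q') ≠ s(p, q)) (hx : Sbtw ℝ p x q) : ¬Wbtw ℝ p' x q' := by
  intro hx'
  have hxV : x ∉ vertices e := fun hxV => h.not_sbtw x hxV hx
  have hs' : Sbtw ℝ p' x q' :=
    ⟨hx', fun heq => hxV (heq ▸ h'.left_mem), fun heq => hxV (heq ▸ h'.right_mem)⟩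
  obtain ⟨i, hpi, hqi⟩ := h.exists_support
  obtain ⟨j, hpj, hqj⟩ := h'.exists_support
  obtain ⟨y, ⟨hyi, hyj⟩, z, ⟨hzi, hzj⟩, hyz⟩ :
      ((e i).support ∩ (e j).support).Nontrivial := by
    refine Set.not_subsingleton_iff.mp fun hsub => hxV (Or.inr (Set.mem_iUnion₂.mpr ⟨i, j, ?_⟩))
    exact ⟨⟨StraightEdge.mem_support_of_sbtw hpi hqi hx,
      StraightEdge.mem_support_of_sbtw hpj hqj hs'⟩, hsub⟩
  have hline : line[ℝ, (e j).src, (e j).tgt] = line[ℝ, p, q] := by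
    rw [← affineSpan_pair_eq_of_mem_of_mem_of_ne ((e j).support_subset_line hyj)
        ((e j).support_subset_line hzj) hyz,
      affineSpan_pair_eq_of_mem_of_mem_of_ne ((e i).support_subset_line hyi)
        ((e i).support_subset_line hzi) hyz,
      affineSpan_pair_eq_of_mem_of_mem_of_ne ((e i).support_subset_line hpi)
        ((e i).support_subset_line hqi) h.ne]
  exact hne (sym2_eq_of_sbtw (hline ▸ (e j).support_subset_line hpj)
    (hline ▸ (e j).support_subset_line hqj) hx hs' (h.not_sbtw _ h'.left_mem)
    (h.not_sbtw _ h'.right_mem) (h'.not_sbtw _ h.left_mem) (h'.not_sbtw _ h.right_mem))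

lemma IsLink.eq_zero_or_eq_one {d d' : StraightEdge} (h : IsLink e d.src d.tgt)
    (h' : IsLink e d'.src d'.tgt) (hne : s(d'.src, d'.tgt) ≠ s(d.src, d.tgt)) {s t : ℝ}
    (hs : s ∈ Set.Icc (0 : ℝ) 1) (ht : t ∈ Set.Icc (0 : ℝ) 1)
    (hst : d.toCurve.toFun s = d'.toCurve.toFun t) : s = 0 ∨ s = 1 := by
  have hline : ∀ (e : StraightEdge) (r : ℝ),
      e.toCurve.toFun r = AffineMap.lineMap e.src e.tgt r := fun e r => by
    rw [AffineMap.lineMap_apply_module', add_comm]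
    rfl
  rw [hline, hline] at hst
  by_contra! hcon
  refine h.notMem_of_sbtw h' hne (x := AffineMap.lineMap d.src d.tgt s) ?_ ?_
  · exact sbtw_lineMap_iff.mpr
      ⟨d.ne, lt_of_le_of_ne hs.1 hcon.1.symm, lt_of_le_of_ne hs.2 hcon.2⟩
  · exact hst ▸ ⟨t, ht, rfl⟩

lemma isGraph_of_isLink {m : ℕ} {d : Fin m → StraightEdge}
    (hd : ∀ j, IsLink e (d j).src (d j).tgt)
    (hinj : Function.Injective fun j => s((d j).src, (d j).tgt)) :
    IsGraph fun j => (d j).toCurve := by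
  refine ⟨fun j => ?_, fun i j hij s hs t ht h => ⟨?_, ?_⟩⟩
  · obtain ⟨han, hne⟩ := analyticOn_Icc_of_eqOn_affine (f := (d j).toCurve.toFun) zero_lt_one
      one_ne_zero (d j).dir_ne_zero (l := 0) (x := (d j).src) fun t _ => by
        simp only [StraightEdge.toCurve, StraightEdge.dir, one_mul, add_zero]
    exact ⟨han, fun s _ t _ h =>
      smul_left_injective ℝ (d j).dir_ne_zero (add_left_cancel h), hne⟩
  · exact (hd i).eq_zero_or_eq_one (hd j) (fun h => hij (hinj h).symm) hs ht h
  · exact (hd j).eq_zero_or_eq_one (hd i) (fun h => hij (hinj h)) ht hs h.symm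

lemma sbtw_induction {E : Type*} [AddCommGroup E] [Module ℝ E] {V : Set E} (hV : V.Finite)
    {P : E → E → Prop}
    (base : ∀ p ∈ V, ∀ q ∈ V, p ≠ q → (∀ x ∈ V, ¬Sbtw ℝ p x q) → P p q)
    (split : ∀ p x q, Sbtw ℝ p x q → P p x → P x q → P p q) {p q : E} (hp : p ∈ V) (hq : q ∈ V)
    (hpq : p ≠ q) : P p q := by
  have hfin : ∀ p q, {x ∈ V | Sbtw ℝ p x q}.Finite := fun p q => hV.subset (Set.sep_subset _ _)
  induction hN : {x ∈ V | Sbtw ℝ p x q}.ncard using Nat.strong_induction_on generalizing p q with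
  | _ N ih =>
    subst hN
    by_cases hempty : ∀ x ∈ V, ¬Sbtw ℝ p x q
    · exact base p hp q hq hpq hempty
    · push Not at hempty
      obtain ⟨x, hxV, hx⟩ := hempty
      have hlt₁ : {y ∈ V | Sbtw ℝ p y x}.ncard < {y ∈ V | Sbtw ℝ p y q}.ncard :=
        Set.ncard_lt_ncard ⟨fun y hy => ⟨hy.1, hx.trans_left hy.2⟩,
          fun h => not_sbtw_self_right ℝ p x (h ⟨hxV, hx⟩).2⟩ (hfin p q)
      have hlt₂ : {y ∈ V | Sbtw ℝ x y q}.ncard < {y ∈ V | Sbtw ℝ p y q}.ncard :=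
        Set.ncard_lt_ncard ⟨fun y hy => ⟨hy.1, hx.trans_right hy.2⟩,
          fun h => not_sbtw_self_left ℝ x q (h ⟨hxV, hx⟩).2⟩ (hfin p q)
      exact split p x q hx (ih _ hlt₁ hp hxV hx.left_ne rfl) (ih _ hlt₂ hxV hq hx.ne_right rfl)

lemma isWord_of_isLink {m : ℕ} {d : Fin m → StraightEdge}
    (hd : ∀ p q, IsLink e p q → ∃ j, s((d j).src, (d j).tgt) = s(p, q)) (i : Fin n) :
    IsWord d (e i) := by
  suffices h : ∀ hne : (e i).src ≠ (e i).tgt, IsWord d ⟨(e i).src, (e i).tgt, hne⟩ from h _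
  refine sbtw_induction (V := vertices e ∩ (e i).support)
    (P := fun p q => ∀ hne : p ≠ q, IsWord d ⟨p, q, hne⟩)
    ((finite_vertices e).subset Set.inter_subset_left) ?_ ?_
    ⟨src_mem_vertices e i, left_mem_segment ℝ _ _⟩
    ⟨tgt_mem_vertices e i, right_mem_segment ℝ _ _⟩ (e i).ne
  · intro p hp q hq hpq hempty hne
    obtain ⟨j, hj⟩ := hd p q ⟨hpq, hp.1, hq.1, ⟨i, hp.2, hq.2⟩, fun x hxV hx =>
      hempty x ⟨hxV, StraightEdge.mem_support_of_sbtw hp.2 hq.2 hx⟩ hx⟩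
    rcases Sym2.eq_iff.mp hj with ⟨rfl, rfl⟩ | ⟨rfl, rfl⟩
    · exact isWord_self d j
    · exact (isWord_self d j).reverse
  · exact fun p x q hx h₁ h₂ _ => .of_sbtw hx (h₁ hx.left_ne) (h₂ hx.ne_right)

lemma exists_isGraph_forall_isWord (e : Fin n → StraightEdge) :
    ∃ (m : ℕ) (d : Fin m → StraightEdge), IsGraph (fun j => (d j).toCurve) ∧
      ∀ i, IsWord d (e i) := by
  have hfin : ((fun v : Space × Space => s(v.1, v.2)) '' {v | IsLink e v.1 v.2}).Finite :=
    (((finite_vertices e).prod (finite_vertices e)).subset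
      fun _ h => ⟨h.left_mem, h.right_mem⟩).image _
  obtain ⟨m, f, hf⟩ := hfin.fin_embedding
  have hlink : ∀ j, ∃ v : Space × Space, IsLink e v.1 v.2 ∧ s(v.1, v.2) = f j := fun j =>
    hf.le ⟨j, rfl⟩
  choose v hv hvf using hlink
  refine ⟨m, fun j => ⟨(v j).1, (v j).2, (hv j).ne⟩, isGraph_of_isLink hv ?_, fun i =>
    isWord_of_isLink (fun p q hpq => ?_) i⟩
  · exact fun i j hij => f.injective (by rw [← hvf, ← hvf]; exact hij)
  · obtain ⟨j, hj⟩ : s(p, q) ∈ Set.range f := hf.ge ⟨(p, q), hpq, rfl⟩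
    exact ⟨j, (hvf j).trans hj⟩

end Subdivision

/-! ### The two transforms -/

section Transforms

variable {μ : MeasureTheory.Measure (GenConn SU2)} (hμ : IsAshtekarLewandowski μ)

include hμ in
lemma eq_zero_of_mem_holCyl {W : GenConn SL2 → ℂ} (hW : W ∈ HolCyl)
    (h0 : ∀ A : GenConn SU2, W A.complexify = 0) : W = 0 := by
  obtain ⟨n, e, f, hf, hWf⟩ := hW
  obtain ⟨m, d, hgraph, hword⟩ := exists_isGraph_forall_isWord e
  choose w hw hmem hA using hword
  have hval (A : GenConn SL2) : W A = f fun i => w i fun j => A.toFun (d j).toCurve := by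
    simp only [hWf, hA]
  have hd : DifferentiableOn ℂ (fun g : Fin m → Mat => f fun i => w i g) {g | ∀ i, g i ∈ SL2} :=
    hf.differentiableOn.comp (differentiable_pi.mpr hw).differentiableOn
      fun g hg i => hmem i g hg
  have hSU (g : Fin m → Mat) (hg : ∀ i, g i ∈ SU2) : (f fun i => w i g) = 0 := by
    have hc : ContinuousWithinAt (fun g : Fin m → Mat => f fun i => w i g)
        (Set.range fun (A : GenConn SU2) j => A.toFun (d j).toCurve) g := by
      refine (hd.continuousOn g fun i => SU2_subset_SL2 (hg i)).mono ?_
      rintro _ ⟨A, rfl⟩ i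
      exact SU2_subset_SL2 (A.mem _)
    have hmaps : Set.MapsTo (fun g : Fin m → Mat => f fun i => w i g)
        (Set.range fun (A : GenConn SU2) j => A.toFun (d j).toCurve) {0} := by
      rintro _ ⟨A, rfl⟩
      exact (hval A.complexify).symm.trans (h0 A)
    simpa using hc.mem_closure (mem_closure_range_holonomies hμ hgraph hg) hmaps
  funext A
  rw [hval]
  exact eq_zero_of_eqOn_specialUnitaryGroup hd hSU fun i => A.mem _

section Full

variable {Chat : Hilb μ →ₗ.[ℂ] Hilb μ} (hChat : Chat.IsFormalAdjoint Chat)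

include hμ hChat

lemma holTransform_eq_zero_of_fst {W : GenConn SL2 → ℂ}
    (h : ((0 : Cyl), W) ∈ holTransform μ Chat) : W = 0 := by
  obtain ⟨hW, x, y, hx, hxy, hy⟩ := h
  have := hμ.faithful
  obtain rfl : x = 0 := MeasureTheory.Lp.eq_zero_iff_ae_eq_zero.mpr hx
  obtain rfl := hxy.eq_zero_of_left hChat
  have hae : (fun A : GenConn SU2 => W A.complexify) =ᵐ[μ] fun _ => 0 :=
    hy.symm.trans (MeasureTheory.Lp.coeFn_zero _ _ _)
  have hcont := (continuous_of_mem_cyl hW).comp continuous_complexify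
  exact eq_zero_of_mem_holCyl hμ hW
    (congrFun ((hcont.ae_eq_iff_eq μ continuous_const).mp hae))

lemma holTransform_eq_zero_of_snd {Φ : Cyl} (h : (Φ, 0) ∈ holTransform μ Chat) : Φ = 0 := by
  obtain ⟨-, x, y, hx, hxy, hy⟩ := h
  have := hμ.faithful
  obtain rfl : y = 0 := MeasureTheory.Lp.eq_zero_iff_ae_eq_zero.mpr hy
  obtain rfl := hxy.eq_zero_of_right hChat
  have hae : (Φ : GenConn SU2 → ℂ) =ᵐ[μ] fun _ => 0 :=
    hx.symm.trans (MeasureTheory.Lp.coeFn_zero _ _ _)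
  exact Subtype.ext (((continuous_of_mem_cyl Φ.2).ae_eq_iff_eq μ continuous_const).mp hae)

end Full

variable {A₀ : SmoothConn} {a : ℝ} (ha : ∀ x v, A₀.1 x v = a • v) {G γ : ℝ} {CS : ℝ → ℝ}

lemma IsBohrCoeff.unique {φ : ℝ → ℂ} {ν : ℝ} {x y : ℂ} (hx : IsBohrCoeff φ ν x)
    (hy : IsBohrCoeff φ ν y) : x = y :=
  tendsto_nhds_unique hx.2 hy.2

include ha in
lemma holTransformS_eq_zero_of_fst {w : ℂ → ℂ}
    (h : ((0 : CylS A₀), w) ∈ holTransformS G γ A₀ CS) : w = 0 := by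
  obtain ⟨hd, hmem, hexp⟩ := h
  have h0 : (fun c : ℝ => w c) = 0 := eq_zero_of_mem_cylS ha hmem fun ν => by
    obtain ⟨b, hb, hb'⟩ := hexp ν
    rwa [hb.unique (isBohrCoeff_zero ν), mul_zero] at hb'
  exact eq_of_differentiable_of_eqOn_real hd (differentiable_const 0) (congrFun h0)

include ha in
lemma holTransformS_eq_zero_of_snd {φ : CylS A₀} (h : (φ, 0) ∈ holTransformS G γ A₀ CS) :
    φ = 0 := by
  obtain ⟨-, -, hexp⟩ := h
  refine Subtype.ext (eq_zero_of_mem_cylS ha φ.2 fun ν => ?_)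
  obtain ⟨b, hb, hb'⟩ := hexp ν
  have hexp0 : ((Real.exp (-CS (8 * Real.pi * γ * G / 3 * (ν / 2))) : ℝ) : ℂ) ≠ 0 :=
    Complex.ofReal_ne_zero.mpr (Real.exp_ne_zero _)
  rwa [(mul_eq_zero.mp (hb'.unique (isBohrCoeff_zero ν))).resolve_left hexp0] at hb

include hμ ha in
lemma bProj_graph {Chat : Hilb μ →ₗ.[ℂ] Hilb μ} (hChat : Chat.IsFormalAdjoint Chat)
    (s : ℂ → SmoothConnC) :
    (bProj G γ A₀ μ Chat CS s).graph = bProjGraph G γ A₀ μ Chat CS s := by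
  refine Submodule.toLinearPMap_graph_eq _ ?_
  rintro ⟨Φ, φ⟩ ⟨W, hW, hWs⟩ (rfl : Φ = 0)
  rw [holTransform_eq_zero_of_fst hμ hChat hW] at hWs
  exact holTransformS_eq_zero_of_snd ha hWs

end Transforms

/-! ### Multiplication operators and dual actions -/

section DualAction

variable {V V' X X' : Type} [AddCommGroup V] [Module ℂ V] [AddCommGroup V'] [Module ℂ V']

lemma mulGraph_toLinearPMap_graph {U : Submodule ℂ (V × (X → ℂ))}
    (hfst : ∀ W, ((0 : V), W) ∈ U → W = 0) (hsnd : ∀ v, (v, (0 : X → ℂ)) ∈ U → v = 0)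
    (F : X → ℂ) : (mulGraph U F).toLinearPMap.graph = mulGraph U F := by
  refine Submodule.toLinearPMap_graph_eq _ ?_
  rintro ⟨v, v'⟩ ⟨W, hW, hW'⟩ (rfl : v = 0)
  rw [hfst W hW, mul_zero] at hW'
  exact hsnd v' hW'

lemma eq_of_mem_of_mem {p : Submodule ℂ (V × V')} (hp : ∀ w, ((0 : V), w) ∈ p → w = 0) {v : V}
    {w w' : V'} (h : (v, w) ∈ p) (h' : (v, w') ∈ p) : w = w' := by
  have hsub := p.sub_mem h h'
  rw [Prod.mk_sub_mk, sub_self] at hsub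
  exact sub_eq_zero.mp (hp _ hsub)

lemma mem_graph_dualAct {T : V →ₗ.[ℂ] V'} {Λ : V' →ₗ.[ℂ] ℂ} {v : V} {y : ℂ} :
    (v, y) ∈ (dualAct T Λ).graph ↔ ∃ w, (v, w) ∈ T.graph ∧ (w, y) ∈ Λ.graph := by
  constructor
  · intro h
    obtain ⟨⟨_, x, hx, rfl⟩, rfl, rfl⟩ := (LinearPMap.mem_graph_iff _).mp h
    exact ⟨T x, T.mem_graph x, Λ.mem_graph ⟨T x, hx⟩⟩
  · rintro ⟨w, hT, hΛ⟩
    obtain ⟨x, rfl, rfl⟩ := (LinearPMap.mem_graph_iff _).mp hT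
    obtain ⟨⟨_, hx⟩, rfl, hy⟩ := (LinearPMap.mem_graph_iff _).mp hΛ
    exact (LinearPMap.mem_graph_iff _).mpr ⟨⟨x, x, hx, rfl⟩, rfl, hy⟩

lemma mem_domain_dualAct {T : V →ₗ.[ℂ] V'} {Λ : V' →ₗ.[ℂ] ℂ} {v : V} :
    v ∈ (dualAct T Λ).domain ↔ ∃ w, (v, w) ∈ T.graph ∧ w ∈ Λ.domain := by
  simp only [LinearPMap.mem_domain_iff, mem_graph_dualAct]
  grind

lemma mem_graph_domRestrict {f : V →ₗ.[ℂ] V'} {S : Submodule ℂ V} {v : V} {y : V'} :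
    (v, y) ∈ (f.domRestrict S).graph ↔ v ∈ S ∧ (v, y) ∈ f.graph := by
  constructor
  · intro h
    obtain ⟨⟨x, hx⟩, rfl, rfl⟩ := (LinearPMap.mem_graph_iff _).mp h
    exact ⟨hx.1, (LinearPMap.mem_graph_iff _).mpr ⟨⟨x, hx.2⟩, rfl, rfl⟩⟩
  · rintro ⟨hS, hf⟩
    obtain ⟨x, rfl, rfl⟩ := (LinearPMap.mem_graph_iff _).mp hf
    exact (LinearPMap.mem_graph_iff _).mpr ⟨⟨x, hS, x.2⟩, rfl, rfl⟩

lemma dualAct_dualAct_domRestrict_eq {U : Submodule ℂ (V × (X → ℂ))}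
    {U' : Submodule ℂ (V' × (X' → ℂ))} (hU : ∀ W, ((0 : V), W) ∈ U → W = 0)
    (hU' : ∀ w, ((0 : V'), w) ∈ U' → w = 0) {σ : X' → X} {F : X → ℂ} {T : V →ₗ.[ℂ] V'}
    {M : V →ₗ.[ℂ] V} {M' : V' →ₗ.[ℂ] V'}
    (hT : ∀ v v', (v, v') ∈ T.graph ↔ ∃ W, (v, W) ∈ U ∧ (v', W ∘ σ) ∈ U')
    (hM : M.graph = mulGraph U F) (hM' : M'.graph = mulGraph U' (F ∘ σ)) (Λ : V' →ₗ.[ℂ] ℂ) :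
    (dualAct M (dualAct T Λ)).domRestrict T.domain =
      (dualAct T (dualAct M' Λ)).domRestrict M.domain := by
  refine LinearPMap.eq_of_eq_graph ?_
  ext ⟨v, y⟩
  simp only [mem_graph_domRestrict, mem_graph_dualAct, LinearPMap.mem_domain_iff, hT, hM, hM']
  constructor
  · rintro ⟨⟨φ, W₀, hW₀, hφ⟩, v', ⟨W, hW, hFW⟩, φ', ⟨W', hW', hφ'⟩, hΛ⟩
    obtain rfl := eq_of_mem_of_mem hU hW₀ hW
    obtain rfl := eq_of_mem_of_mem hU hW' hFW
    exact ⟨⟨v', W₀, hW₀, hFW⟩, φ, ⟨W₀, hW₀, hφ⟩, φ', ⟨_, hφ, hφ'⟩, hΛ⟩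
  · rintro ⟨⟨v', W₀, hW₀, hFW⟩, φ, ⟨W, hW, hφ⟩, φ', ⟨w, hw, hφ'⟩, hΛ⟩
    obtain rfl := eq_of_mem_of_mem hU hW₀ hW
    obtain rfl := eq_of_mem_of_mem hU' hw hφ
    exact ⟨⟨φ, W₀, hW₀, hφ⟩, v', ⟨W₀, hW₀, hFW⟩, φ', ⟨_, hFW, hφ'⟩, hΛ⟩

end DualAction

/-! ### Trigonometric polynomials -/

/-- The algebra of trigonometric polynomials `∑ a_ν e^{iνz/2}` with real frequencies. -/
def trigPoly : Subalgebra ℂ (ℂ → ℂ) := Algebra.adjoin ℂ (Set.range expFn)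

lemma expFn_mem_trigPoly (ν : ℝ) : expFn ν ∈ trigPoly := Algebra.subset_adjoin ⟨ν, rfl⟩

lemma trigPoly_toSubmodule :
    Subalgebra.toSubmodule trigPoly = Submodule.span ℂ (Set.range expFn) := by
  refine Algebra.adjoin_eq_span_of_subset (R := ℂ) (s := Set.range expFn) ?_
  refine Set.Subset.trans (fun x => Submonoid.closure_induction (fun _ => id) ⟨0, expFn_zero⟩ ?_)
    Submodule.subset_span
  rintro _ _ _ _ ⟨ν, rfl⟩ ⟨ν', rfl⟩
  exact ⟨ν + ν', (expFn_mul ν ν').symm⟩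

lemma trace_mul_mem_cyl (𝕜 : Type) [NontriviallyNormedField 𝕜] [NormedAlgebra 𝕜 ℂ] (S : Set Mat)
    (M : Mat) (e : StraightEdge) :
    (fun A : GenConn S => (M * A.toFun e.toCurve).trace) ∈ cyl 𝕜 S := by
  have h : (fun A : GenConn S => (M * A.toFun e.toCurve).trace) =
      ∑ i, ∑ j, M i j • fun A : GenConn S => A.toFun e.toCurve j i := by
    funext A
    simp only [Matrix.trace, Matrix.diag_apply, Matrix.mul_apply, Finset.sum_apply, Pi.smul_apply,
      smul_eq_mul]
  rw [h]
  exact sum_mem fun i _ => sum_mem fun j _ => Submodule.smul_mem _ _ (entry_mem_cyl 𝕜 S e j i)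

section TrigPoly

variable {A₀ : SmoothConn} {a : ℝ} (ha : ∀ x v, A₀.1 x v = a • v)

include ha

lemma expFn_mul_norm_mem_cylS (e : StraightEdge) :
    (fun c : ℝ => expFn (a * ‖e.dir‖) c) ∈ CylS A₀ := by
  refine ⟨_, trace_mul_mem_cyl ℝ SU2 (axisProj e.dir) e, funext fun c => ?_⟩
  rw [LinearMap.funLeft_apply, symmConn_toCurve ha, trace_axisProj_mul_rotMat e.dir_ne_zero]

lemma expFn_neg_mul_norm_mem_cylS (e : StraightEdge) :
    (fun c : ℝ => expFn (-(a * ‖e.dir‖)) c) ∈ CylS A₀ := by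
  refine ⟨_, trace_mul_mem_cyl ℝ SU2 (axisProj (-e.dir)) e, funext fun c => ?_⟩
  have hneg (ζ : ℂ) : rotMat e.dir ζ = rotMat (-e.dir) ζ⁻¹ := by
    rw [rotMat, rotMat, inv_inv, neg_neg, add_comm]
  rw [LinearMap.funLeft_apply, symmConn_toCurve ha, hneg,
    trace_axisProj_mul_rotMat (neg_ne_zero.mpr e.dir_ne_zero), expFn_neg]

lemma expFn_mem_cylS (ha0 : a ≠ 0) (ν : ℝ) : (fun c : ℝ => expFn ν c) ∈ CylS A₀ := by
  rcases eq_or_ne ν 0 with rfl | hν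
  · refine ⟨fun _ => 1, ⟨0, Fin.elim0, fun _ => 1, analyticOn_const, fun _ => rfl⟩, ?_⟩
    funext c
    rw [expFn_zero]
    rfl
  let v : Space := EuclideanSpace.single 2 (ν / a)
  have hv : ‖v‖ = |ν / a| := PiLp.norm_single 2 (fun _ : Fin 3 => ℝ) 2 (ν / a)
  have hv0 : 0 ≠ v := (norm_ne_zero_iff.mp (hv ▸ abs_ne_zero.mpr (div_ne_zero hν ha0))).symm
  let e : StraightEdge := ⟨0, v, hv0⟩
  have he : ‖e.dir‖ = |ν / a| := by rw [← hv, StraightEdge.dir, sub_zero]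
  rcases abs_choice (ν / a) with h | h
  · convert expFn_mul_norm_mem_cylS ha e using 3
    rw [he, h, mul_div_cancel₀ ν ha0]
  · convert expFn_neg_mul_norm_mem_cylS ha e using 3
    rw [he, h, mul_neg, neg_neg, mul_div_cancel₀ ν ha0]

lemma exists_mem_holTransformS_expFn (ha0 : a ≠ 0) (G γ : ℝ) (CS : ℝ → ℝ) (ν : ℝ) :
    ∃ φ, (φ, expFn ν) ∈ holTransformS G γ A₀ CS := by
  have hmem := expFn_mem_cylS ha ha0 ν
  set k : ℂ := ((Real.exp (CS (8 * Real.pi * γ * G / 3 * (ν / 2))) : ℝ) : ℂ) with hk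
  refine ⟨k • ⟨_, hmem⟩, differentiable_expFn ν, hmem, fun κ => ?_⟩
  have h := isBohrCoeff_expFn ν κ
  refine ⟨_, h.smul k, ?_⟩
  convert h using 1
  split_ifs with hνκ
  · rw [← hνκ, hk, mul_one, ← Complex.ofReal_mul, ← Real.exp_add, neg_add_cancel, Real.exp_zero,
      Complex.ofReal_one]
  · rw [mul_zero, mul_zero]

lemma exists_mem_holTransformS (ha0 : a ≠ 0) (G γ : ℝ) (CS : ℝ → ℝ) {w : ℂ → ℂ}
    (hw : w ∈ trigPoly) : ∃ φ, (φ, w) ∈ holTransformS G γ A₀ CS := by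
  have hle : Submodule.span ℂ (Set.range expFn) ≤
      (holTransformS G γ A₀ CS).map (LinearMap.snd ℂ (CylS A₀) (ℂ → ℂ)) := by
    rw [Submodule.span_le]
    rintro _ ⟨ν, rfl⟩
    obtain ⟨φ, hφ⟩ := exists_mem_holTransformS_expFn ha ha0 G γ CS ν
    exact ⟨_, hφ, rfl⟩
  rw [← trigPoly_toSubmodule] at hle
  obtain ⟨⟨φ, _⟩, hφ, rfl⟩ := hle hw
  exact ⟨φ, hφ⟩

variable {s : ℂ → SmoothConnC} (hs : ∀ z, (s z).1 = scaledForm A₀ z)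

include hs

lemma entry_viaHolonomies_mem_trigPoly (e : StraightEdge) (i j : Fin 2) :
    (fun z => (viaHolonomies s z).toFun e.toCurve i j) ∈ trigPoly := by
  have h : (fun z => (viaHolonomies s z).toFun e.toCurve i j) =
      axisProj e.dir i j • expFn (a * ‖e.dir‖) +
        axisProj (-e.dir) i j • expFn (-(a * ‖e.dir‖)) := by
    funext z
    rw [viaHolonomies_toCurve ha hs, rotMat, ← expFn_neg]
    simp only [Matrix.add_apply, Matrix.smul_apply, Pi.add_apply, Pi.smul_apply, smul_eq_mul,
      mul_comm]
  rw [h]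
  exact add_mem (Subalgebra.smul_mem _ (expFn_mem_trigPoly _) _)
    (Subalgebra.smul_mem _ (expFn_mem_trigPoly _) _)

lemma IsPolyCyl.comp_viaHolonomies_mem_trigPoly {W : GenConn SL2 → ℂ} (hW : IsPolyCyl W) :
    W ∘ viaHolonomies s ∈ trigPoly := by
  obtain ⟨n, e, P, hP⟩ := hW
  rw [show W ∘ viaHolonomies s = fun z => MvPolynomial.eval
    (fun k => (viaHolonomies s z).toFun (e k.1).toCurve k.2.1 k.2.2) P from funext fun z => hP _]
  clear hP
  induction P using MvPolynomial.induction_on with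
  | C c =>
    simp only [MvPolynomial.eval_C]
    exact trigPoly.algebraMap_mem c
  | add P Q hP hQ =>
    simp only [map_add]
    exact trigPoly.add_mem hP hQ
  | mul_X P k hP =>
    simp only [map_mul, MvPolynomial.eval_X]
    exact trigPoly.mul_mem hP (entry_viaHolonomies_mem_trigPoly ha hs _ _ _)

end TrigPoly

lemma apply_ofReal_eq_scaledForm {G γ : ℝ} {A₀ : SmoothConn} {dC : ℝ → SmoothConn}
    (hdC : (dC 0).1 = 0) {CS : ℝ → ℝ} (hCS : deriv CS 0 = 0) {s : ℂ → SmoothConnC}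
    (hs : ∀ c p : ℝ, (s (zCoord G γ CS c p)).1 = complexConn G γ A₀ c (dC p)) (c : ℝ) :
    (s c).1 = scaledForm A₀ c := by
  have hz : zCoord G γ CS c 0 = c := by simp [zCoord, hCS]
  rw [← hz, hs c 0]
  funext x
  ext v i
  simp [complexConn, hdC, toComplexForm, hz]

end

end LoopQG

theorem proposition2_general {A₀ : SmoothConn} (hinv : IsEuclideanInvariant A₀.1)
    (hA₀ : A₀.1 ≠ 0) {μ : MeasureTheory.Measure (GenConn SU2)} (hμ : IsAshtekarLewandowski μ)
    {Chat : Hilb μ →ₗ.[ℂ] Hilb μ} (hChat : Chat.IsFormalAdjoint Chat) (G γ : ℝ) (CS : ℝ → ℝ)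
    {s : ℂ → SmoothConnC} (hreal : ∀ c : ℝ, (s c).1 = scaledForm A₀ c)
    (hshol : IsHolomorphicMap s) {F : GenConn SL2 → ℂ} (hF : F ∈ HolCyl) :
    IsHolCylS (F ∘ viaHolonomies s) ∧
    (bProj G γ A₀ μ Chat CS s).graph = bProjGraph G γ A₀ μ Chat CS s ∧
    (quantized μ Chat F).graph = mulGraph (holTransform μ Chat) F ∧
    (quantizedS G γ A₀ CS (F ∘ viaHolonomies s)).graph =
      mulGraph (holTransformS G γ A₀ CS) (F ∘ viaHolonomies s) ∧
    (∀ ψ : Module.Dual ℂ (CylS A₀),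
      (dualAct (quantized μ Chat F)
          (bEmbed G γ A₀ μ Chat CS s (ψ.toPMap ⊤))).domRestrict
        (bProj G γ A₀ μ Chat CS s).domain =
      (bEmbed G γ A₀ μ Chat CS s
          (dualAct (quantizedS G γ A₀ CS (F ∘ viaHolonomies s)) (ψ.toPMap ⊤))).domRestrict
        (quantized μ Chat F).domain) ∧
    (∀ (Φ : Cyl) (W : GenConn SL2 → ℂ), (Φ, W) ∈ holTransform μ Chat → IsPolyCyl W →
      Φ ∈ (bProj G γ A₀ μ Chat CS s).domain ∧
      (IsPolyCyl F → ∀ ψ : Module.Dual ℂ (CylS A₀),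
        Φ ∈ (bEmbed G γ A₀ μ Chat CS s
          (dualAct (quantizedS G γ A₀ CS (F ∘ viaHolonomies s)) (ψ.toPMap ⊤))).domain)) := by
  obtain ⟨a, ha⟩ := hinv.exists_eq_smul
  have ha0 : a ≠ 0 := fun h => hA₀ (by ext x v i; simp [ha, h])
  have hs := hshol.eq_scaledForm hreal
  have hU (W) := holTransform_eq_zero_of_fst hμ hChat (W := W)
  have hUS (w) := holTransformS_eq_zero_of_fst ha (G := G) (γ := γ) (CS := CS) (w := w)
  have hπ := bProj_graph (G := G) (γ := γ) (CS := CS) hμ ha hChat s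
  have hgF : (quantized μ Chat F).graph = mulGraph (holTransform μ Chat) F :=
    mulGraph_toLinearPMap_graph hU (fun _ => holTransform_eq_zero_of_snd hμ hChat) F
  have hgS : (quantizedS G γ A₀ CS (F ∘ viaHolonomies s)).graph =
      mulGraph (holTransformS G γ A₀ CS) (F ∘ viaHolonomies s) :=
    mulGraph_toLinearPMap_graph hUS (fun _ => holTransformS_eq_zero_of_snd ha) _
  refine ⟨isHolCylS_comp_viaHolonomies ha hs hF, hπ, hgF, hgS, fun ψ =>
    dualAct_dualAct_domRestrict_eq hU hUS (fun _ _ => by rw [hπ]; rfl) hgF hgS _,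
    fun Φ W hW hWp => ?_⟩
  have hWt := hWp.comp_viaHolonomies_mem_trigPoly ha hs
  obtain ⟨φ, hφ⟩ := exists_mem_holTransformS ha ha0 G γ CS hWt
  have hΦφ : (Φ, φ) ∈ (bProj G γ A₀ μ Chat CS s).graph := hπ ▸ ⟨W, hW, hφ⟩
  refine ⟨LinearPMap.mem_domain_iff.mpr ⟨φ, hΦφ⟩, fun hFp ψ => ?_⟩
  obtain ⟨φ', hφ'⟩ := exists_mem_holTransformS ha ha0 G γ CS
    (trigPoly.mul_mem (hFp.comp_viaHolonomies_mem_trigPoly ha hs) hWt)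
  exact mem_domain_dualAct.mpr ⟨φ, hΦφ, mem_domain_dualAct.mpr
    ⟨φ', hgS ▸ ⟨_, hφ, hφ'⟩, trivial⟩⟩

theorem proposition2
    (G γ ℓ : ℝ) (hG : 0 < G) (hγ : 0 < γ) (hℓ : 0 < ℓ)
    (A₀ : SmoothConn) (hinv : IsEuclideanInvariant A₀.1) (hA₀ : A₀.1 ≠ 0)
    (μ : MeasureTheory.Measure (GenConn SU2)) (hμ : IsAshtekarLewandowski μ)
    (C : RealForm → ℝ) (hC : ∀ E, 0 ≤ C E)
    (dC : ℝ → SmoothConn) (hdC : ∀ p, HasFunctionalDeriv C (symmTriad ℓ A₀ p) (dC p))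
    (hdC0 : ∀ p, (dC p).1 = 0 ↔ p = 0)
    (Chat : Hilb μ →ₗ.[ℂ] Hilb μ) (hsa : IsSelfAdjoint Chat)
    (hpos : ∀ x : Chat.domain, 0 ≤ (inner ℂ (x : Hilb μ) (Chat x)).re)
    (CS : ℝ → ℝ) (hCS : ∀ p, 0 ≤ CS p) (hCSd : Differentiable ℝ CS)
    (hCS0 : ∀ p, deriv CS p = 0 ↔ p = 0)
    (s : ℂ → SmoothConnC)
    (hs : ∀ c p : ℝ, (s (zCoord G γ CS c p)).1 = complexConn G γ A₀ c (dC p))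
    (hshol : IsHolomorphicMap s)
    (F : GenConn SL2 → ℂ) (hF : F ∈ HolCyl) :
    IsHolCylS (F ∘ viaHolonomies s) ∧
    (bProj G γ A₀ μ Chat CS s).graph = bProjGraph G γ A₀ μ Chat CS s ∧
    (quantized μ Chat F).graph = mulGraph (holTransform μ Chat) F ∧
    (quantizedS G γ A₀ CS (F ∘ viaHolonomies s)).graph =
      mulGraph (holTransformS G γ A₀ CS) (F ∘ viaHolonomies s) ∧
    (∀ ψ : Module.Dual ℂ (CylS A₀),
      (dualAct (quantized μ Chat F)
          (bEmbed G γ A₀ μ Chat CS s (ψ.toPMap ⊤))).domRestrict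
        (bProj G γ A₀ μ Chat CS s).domain =
      (bEmbed G γ A₀ μ Chat CS s
          (dualAct (quantizedS G γ A₀ CS (F ∘ viaHolonomies s)) (ψ.toPMap ⊤))).domRestrict
        (quantized μ Chat F).domain) ∧
    (∀ (Φ : Cyl) (W : GenConn SL2 → ℂ), (Φ, W) ∈ holTransform μ Chat → IsPolyCyl W →
      Φ ∈ (bProj G γ A₀ μ Chat CS s).domain ∧
      (IsPolyCyl F → ∀ ψ : Module.Dual ℂ (CylS A₀),
        Φ ∈ (bEmbed G γ A₀ μ Chat CS s
          (dualAct (quantizedS G γ A₀ CS (F ∘ viaHolonomies s)) (ψ.toPMap ⊤))).domain)) := by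
  exact proposition2_general hinv hA₀ hμ (isFormalAdjoint_self_of_isSelfAdjoint hsa) G γ CS
    (apply_ofReal_eq_scaledForm ((hdC0 0).mpr rfl) ((hCS0 0).mpr rfl) hs) hshol hF
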